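/- Let $n\ge 2$ and $m\ge 2$, let $\Omega\subset\mathbb{R}^n$ be a domain, $x_0\in\Omega$, and let $u$ be a real-valued classical ($C^{2m}$) solution of $\Delta^m u=0$ in $\Omega\setminus\{x_0\}$. Suppose that, as $x\to x_0$, $$|u(x)|=\begin{cases} o\big(|x-x_0|^{2m-n}\big) & \text{if } n\ge 3,\\ o\big(|x-x_0|^{2m-2}\log(1/|x-x_0|)\big) & \text{if } n=2.\end{cases}$$ Then $u$ has a removable singularity at $x_0$: there are $\delta>0$ with $\overline{B_\delta(x_0)}\subset\Omega$ and a smooth solution $v$ of $\Delta^m v=0$ in $B_\delta(x_0)$ such that $u(x)=v(x)$ for all $0<|x-x_0|<\delta$. The bound is sharp in the following sense. If $n\ge 3$, $m\ge 1$, and either $n$ is odd, or $n$ is even and $m\le \frac n2-1$, then the function $\Gamma(x)=|x|^{2m-n}$ satisfies $\Delta^m\Gamma=0$ in $\mathbb{R}^n\setminus\{0\}$ and $\Delta^{m-1}\Gamma(x)=A_{m,n}|x|^{2-n}$ for all $x\ne 0$ with a constant $A_{m,n}\neq 0$, and $\Gamma$ does not have a removable singularity at $0$. -/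

import Mathlib

open Set Filter Topology Asymptotics
open scoped ContDiff

/-- The iterated Laplacian `Δ^k u` of a real function on `ℝⁿ`. -/
noncomputable def iterLaplacian {n : ℕ} (k : ℕ) (u : EuclideanSpace ℝ (Fin n) → ℝ) :
    EuclideanSpace ℝ (Fin n) → ℝ :=
  (fun f : EuclideanSpace ℝ (Fin n) → ℝ =>
    (Laplacian.laplacian f : EuclideanSpace ℝ (Fin n) → ℝ))^[k] u

/-- `u` is a (classical) solution of the polyharmonic equation `Δ^m u = 0` in the open set `U`.
Only the values of `u` on `U` matter, as `U` is open. -/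
def IsPolyharmonicOn {n : ℕ} (m : ℕ) (u : EuclideanSpace ℝ (Fin n) → ℝ)
    (U : Set (EuclideanSpace ℝ (Fin n))) : Prop :=
  ContDiffOn ℝ ((2 * m : ℕ) : WithTop ℕ∞) u U ∧ ∀ x ∈ U, iterLaplacian m u x = 0

/-- A solution `u` of `Δ^m u = 0` in `Ω \ {x₀}` has a removable singularity at `x₀`: on some
punctured ball around `x₀` whose closure lies in `Ω` it agrees with a smooth solution `v` on the
whole ball. -/
def HasRemovableSingularity {n : ℕ} (m : ℕ) (u : EuclideanSpace ℝ (Fin n) → ℝ)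
    (Ω : Set (EuclideanSpace ℝ (Fin n))) (x₀ : EuclideanSpace ℝ (Fin n)) : Prop :=
  ∃ δ : ℝ, 0 < δ ∧ Metric.closedBall x₀ δ ⊆ Ω ∧
    ∃ v : EuclideanSpace ℝ (Fin n) → ℝ,
      ContDiffOn ℝ ∞ v (Metric.ball x₀ δ) ∧ IsPolyharmonicOn m v (Metric.ball x₀ δ) ∧
      ∀ x, 0 < ‖x - x₀‖ → ‖x - x₀‖ < δ → u x = v x

/-! ### Iterated Laplacians: smoothness, supports, scaling, Green's identity -/

section LaplacianBasics

set_option maxSynthPendingDepth 3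

open MeasureTheory

variable {n : ℕ}

local notation "𝔼" => EuclideanSpace ℝ (Fin n)

/-! Removability. Cut `u` off to a small ball around `x₀ = a`; the growth bound makes the result `U`
integrable, so `Δ^m U` is a distribution on the ball, and it vanishes off `a`. It is shown to be a
multiple of the Dirac mass, then to be zero, and regularity of weak solutions finishes.

Dirac mass: a test function vanishing at `a` may be multiplied by a bump of scale `ε` without
changing its pairing. Since it is `O(ε)` on that scale, its `Δ^m` is `O(ε^(1-2m))`, and the pairing
is at most a constant times `ε * scaledMass m U a ε`, which tends to `0`
(`weakIterLaplacian_eq_zero_of_apply_eq_zero`). No derivatives of the Dirac mass survive.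

Zero coefficient: it is enough to find test functions whose pairing is small compared with their
value at `a`. If `U = o(|x-a|^(2m-n))`, then `scaledMass` tends to `0` and a bump of scale `ε`
suffices. In the plane `scaledMass` is only `o(log (1/ε))`. There one tests with a truncated
logarithm, of height about `2 log (1/ε)` at `a` and harmonic between the scales `ε` and `δ`, so its
pairing is controlled by `scaledMass` at these two scales alone.

Regularity: a radial kernel `k` with nonzero integral is built for which `div (x k)` is `Δ^m` of a
test function. The divergence governs the `ε`-derivative of the dilates of `k`, so the `k`-means of
a weak solution do not depend on `ε`. Letting `ε → 0` gives a mean value formula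
(`radialMean_eq_of_weak`); at fixed `ε` the mean is a convolution with a smooth kernel, hence the
smooth extension.

Sharpness. `Δ|x|^k = k(k+n-2)|x|^(k-2)` is iterated: for `k = 2m-n` the last of the `m` factors
vanishes and, under the parity condition, no earlier one does. Even where `|x|^(2m-n)` is bounded,
`Δ^(m-1)` of it blows up at `0`, which a smooth extension forbids. -/

lemma two_le_infty : (2 : WithTop ℕ∞) ≤ ∞ := by
  exact WithTop.coe_le_coe.2 (le_top : (2 : ℕ∞) ≤ ⊤)

/-- The trace of a bilinear form on `ℝⁿ`, as a continuous linear map. -/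
noncomputable def bilinTrace (n : ℕ) :
    (EuclideanSpace ℝ (Fin n) →L[ℝ] EuclideanSpace ℝ (Fin n) →L[ℝ] ℝ) →L[ℝ] ℝ :=
  ∑ i : Fin n, (ContinuousLinearMap.apply ℝ ℝ (EuclideanSpace.basisFun (Fin n) ℝ i)).comp
    (ContinuousLinearMap.apply ℝ (EuclideanSpace ℝ (Fin n) →L[ℝ] ℝ)
      (EuclideanSpace.basisFun (Fin n) ℝ i))

lemma bilinTrace_apply (A : 𝔼 →L[ℝ] 𝔼 →L[ℝ] ℝ) :
    bilinTrace n A = ∑ i : Fin n,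
      A (EuclideanSpace.basisFun (Fin n) ℝ i) (EuclideanSpace.basisFun (Fin n) ℝ i) := by
  simp [bilinTrace]

/-- A fixed continuous linear map applied to the second derivative: smoothness, norm bounds and
chain rules for `fderiv` transfer to the Laplacian through this form. -/
lemma laplacian_eq_bilinTrace (f : 𝔼 → ℝ) :
    Laplacian.laplacian f = fun x => bilinTrace n (fderiv ℝ (fderiv ℝ f) x) := by
  ext x
  rw [InnerProductSpace.laplacian_eq_iteratedFDeriv_orthonormalBasis f
    (EuclideanSpace.basisFun (Fin n) ℝ)]
  simp only [iteratedFDeriv_two_apply, bilinTrace_apply]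
  simp

lemma iterLaplacian_zero (f : 𝔼 → ℝ) : iterLaplacian 0 f = f := rfl

lemma iterLaplacian_succ (m : ℕ) (f : 𝔼 → ℝ) :
    iterLaplacian (m + 1) f = Laplacian.laplacian (iterLaplacian m f) :=
  Function.iterate_succ_apply' _ _ _

lemma iterLaplacian_succ' (m : ℕ) (f : 𝔼 → ℝ) :
    iterLaplacian (m + 1) f = iterLaplacian m (Laplacian.laplacian f) :=
  Function.iterate_succ_apply _ _ _

lemma ContDiffAt.laplacian {k : WithTop ℕ∞} {f : 𝔼 → ℝ} {x : 𝔼} (hf : ContDiffAt ℝ (k + 2) f x) :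
    ContDiffAt ℝ k (Laplacian.laplacian f) x := by
  rw [laplacian_eq_bilinTrace]
  refine (bilinTrace n).contDiff.contDiffAt.comp x ?_
  have h2 : k + 1 + 1 ≤ k + 2 := by rw [add_assoc]; norm_num
  exact (hf.fderiv_right h2).fderiv_right le_rfl

lemma ContDiffAt.iterLaplacian {k : WithTop ℕ∞} {m : ℕ} {f : 𝔼 → ℝ} {x : 𝔼}
    (hf : ContDiffAt ℝ (k + (2 * m : ℕ)) f x) : ContDiffAt ℝ k (iterLaplacian m f) x := by
  induction m generalizing f with
  | zero => simpa [iterLaplacian_zero] using hf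
  | succ m ih =>
    rw [iterLaplacian_succ']
    refine ih (ContDiffAt.laplacian ?_)
    convert! hf using 1
    push_cast
    ring

lemma ContDiff.iterLaplacian {f : 𝔼 → ℝ} (hf : ContDiff ℝ ∞ f) (m : ℕ) :
    ContDiff ℝ ∞ (iterLaplacian m f) := by
  rw [contDiff_iff_contDiffAt]
  refine fun x => ContDiffAt.iterLaplacian ?_
  exact hf.contDiffAt.of_le (by rfl)

lemma iterLaplacian_congr_nhds {f g : 𝔼 → ℝ} {x : 𝔼} (h : f =ᶠ[𝓝 x] g) (m : ℕ) :
    iterLaplacian m f =ᶠ[𝓝 x] iterLaplacian m g := by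
  induction m with
  | zero => exact h
  | succ m ih =>
    rw [iterLaplacian_succ, iterLaplacian_succ]
    exact InnerProductSpace.laplacian_congr_nhds ih

lemma iterLaplacian_const_zero (m : ℕ) : iterLaplacian m (fun _ : 𝔼 => (0 : ℝ)) = fun _ => 0 := by
  induction m with
  | zero => rfl
  | succ m ih => rw [iterLaplacian_succ, ih, InnerProductSpace.laplacian_const]; rfl

lemma iterLaplacian_eq_zero_of_notMem_tsupport {f : 𝔼 → ℝ} {x : 𝔼} (hx : x ∉ tsupport f) (m : ℕ) :
    iterLaplacian m f x = 0 := by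
  have h : f =ᶠ[𝓝 x] fun _ => 0 := notMem_tsupport_iff_eventuallyEq.1 hx
  rw [(iterLaplacian_congr_nhds h m).eq_of_nhds, iterLaplacian_const_zero]

lemma tsupport_iterLaplacian_subset (f : 𝔼 → ℝ) (m : ℕ) :
    tsupport (iterLaplacian m f) ⊆ tsupport f :=
  closure_minimal (fun _ hx => by
    by_contra h
    exact hx (iterLaplacian_eq_zero_of_notMem_tsupport h m)) (isClosed_tsupport f)

lemma HasCompactSupport.iterLaplacian {f : 𝔼 → ℝ} (hf : HasCompactSupport f) (m : ℕ) :
    HasCompactSupport (iterLaplacian m f) :=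
  IsCompact.of_isClosed_subset hf (isClosed_tsupport _) (tsupport_iterLaplacian_subset f m)

lemma iterLaplacian_sub {f g : 𝔼 → ℝ} (hf : ContDiff ℝ ∞ f) (hg : ContDiff ℝ ∞ g) (m : ℕ) :
    iterLaplacian m (fun x => f x - g x) = fun x => iterLaplacian m f x - iterLaplacian m g x := by
  induction m with
  | zero => rfl
  | succ m ih =>
    simp only [iterLaplacian_succ, ih]
    ext x
    exact ContDiffAt.laplacian_sub ((hf.iterLaplacian m).contDiffAt.of_le two_le_infty)
      ((hg.iterLaplacian m).contDiffAt.of_le two_le_infty)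

lemma iterLaplacian_const_mul {f : 𝔼 → ℝ} (hf : ContDiff ℝ ∞ f) (c : ℝ) (m : ℕ) :
    iterLaplacian m (fun x => c * f x) = fun x => c * iterLaplacian m f x := by
  induction m with
  | zero => rfl
  | succ m ih =>
    simp only [iterLaplacian_succ, ih]
    ext x
    exact InnerProductSpace.laplacian_smul c ((hf.iterLaplacian m).contDiffAt.of_le two_le_infty)

lemma laplacian_comp_homothety (f : 𝔼 → ℝ) (a : 𝔼) (c : ℝ) (x : 𝔼) :
    Laplacian.laplacian (fun y => f (c • (y - a))) x =
      c ^ 2 * Laplacian.laplacian f (c • (x - a)) := by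
  have h1 : fderiv ℝ (fun y => f (c • (y - a))) = fun y => c • fderiv ℝ f (c • (y - a)) := by
    ext1 y
    rw [fderiv_comp_sub (f := fun z => f (c • z)), fderiv_comp_smul]
  simp only [laplacian_eq_bilinTrace, h1]
  rw [fderiv_comp_sub (f := fun z => c • fderiv ℝ f (c • z))]
  have h2 : fderiv ℝ (fun z => c • fderiv ℝ f (c • z)) (x - a)
      = c • fderiv ℝ (fun z => fderiv ℝ f (c • z)) (x - a) :=
    congrFun (fderiv_const_smul_field (R := ℝ) (f := fun z => fderiv ℝ f (c • z)) c) (x - a)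
  rw [h2, fderiv_comp_smul, map_smul, map_smul, smul_eq_mul, smul_eq_mul]
  ring

lemma iterLaplacian_comp_homothety {f : 𝔼 → ℝ} (hf : ContDiff ℝ ∞ f) (a : 𝔼) (c : ℝ) (m : ℕ) :
    iterLaplacian m (fun y => f (c • (y - a))) =
      fun x => c ^ (2 * m) * iterLaplacian m f (c • (x - a)) := by
  induction m with
  | zero => simp [iterLaplacian_zero]
  | succ m ih =>
    simp only [iterLaplacian_succ, ih]
    ext x
    have h := InnerProductSpace.laplacian_smul (x := x)
      (f := fun x => iterLaplacian m f (c • (x - a))) (c ^ (2 * m))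
      (((hf.iterLaplacian m).comp (by fun_prop)).contDiffAt.of_le two_le_infty)
    refine h.trans ?_
    rw [laplacian_comp_homothety, smul_eq_mul]
    ring

lemma norm_iteratedFDeriv_laplacian_le {f : 𝔼 → ℝ} (hf : ContDiff ℝ ∞ f) (k : ℕ) (x : 𝔼) :
    ‖iteratedFDeriv ℝ k (Laplacian.laplacian f) x‖ ≤
      ‖bilinTrace n‖ * ‖iteratedFDeriv ℝ (k + 2) f x‖ := by
  rw [laplacian_eq_bilinTrace]
  have h1 : ContDiff ℝ ∞ (fderiv ℝ (fderiv ℝ f)) :=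
    (hf.fderiv_right (m := ∞) (by simp)).fderiv_right (by simp)
  refine ((bilinTrace n).norm_iteratedFDeriv_comp_left (f := fderiv ℝ (fderiv ℝ f))
    h1.contDiffAt (by exact_mod_cast le_top)).trans_eq ?_
  rw [norm_iteratedFDeriv_fderiv, norm_iteratedFDeriv_fderiv]

lemma norm_iteratedFDeriv_iterLaplacian_le {f : 𝔼 → ℝ} (hf : ContDiff ℝ ∞ f) (m k : ℕ) (x : 𝔼) :
    ‖iteratedFDeriv ℝ k (iterLaplacian m f) x‖ ≤
      ‖bilinTrace n‖ ^ m * ‖iteratedFDeriv ℝ (k + 2 * m) f x‖ := by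
  induction m generalizing k with
  | zero => simp [iterLaplacian_zero]
  | succ m ih =>
    rw [iterLaplacian_succ]
    refine (norm_iteratedFDeriv_laplacian_le (hf.iterLaplacian m) k x).trans ?_
    refine (mul_le_mul_of_nonneg_left (ih (k + 2)) (norm_nonneg _)).trans_eq ?_
    rw [pow_succ', mul_assoc, show k + 2 + 2 * m = k + 2 * (m + 1) by ring]

lemma abs_iterLaplacian_le {f : 𝔼 → ℝ} (hf : ContDiff ℝ ∞ f) (m : ℕ) (x : 𝔼) :
    |iterLaplacian m f x| ≤ ‖bilinTrace n‖ ^ m * ‖iteratedFDeriv ℝ (2 * m) f x‖ := by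
  have h := norm_iteratedFDeriv_iterLaplacian_le hf m 0 x
  rwa [norm_iteratedFDeriv_zero, Real.norm_eq_abs, zero_add] at h

lemma integrable_mul_of_tsupport_subset {f g : 𝔼 → ℝ} {V : Set 𝔼} (hV : IsOpen V)
    (hf : ContinuousOn f V) (hg : Continuous g) (hgc : HasCompactSupport g)
    (hgV : tsupport g ⊆ V) : Integrable (fun x => f x * g x) := by
  have hsub : tsupport (fun x => f x * g x) ⊆ tsupport g :=
    closure_mono (Function.support_mul_subset_right f g)
  exact ((hf.mul hg.continuousOn).continuous_of_tsupport_subset hV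
    (hsub.trans hgV)).integrable_of_hasCompactSupport hgc.mul_left

/-- Two integrations by parts in each basis direction. There are no boundary terms, since `g` has
compact support in `V`; `f` may be arbitrary off `V`, which later allows a singular point there. -/
lemma integral_mul_laplacian {f g : 𝔼 → ℝ} {V : Set 𝔼} (hV : IsOpen V)
    (hf : ContDiffOn ℝ 2 f V) (hg : ContDiff ℝ 2 g) (hgc : HasCompactSupport g)
    (hgV : tsupport g ⊆ V) :
    ∫ x, f x * Laplacian.laplacian g x = ∫ x, Laplacian.laplacian f x * g x := by
  have hfd : ContDiffOn ℝ 1 (fderiv ℝ f) V := hf.fderiv_of_isOpen hV (by norm_num)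
  have hfdd : ContinuousOn (fderiv ℝ (fderiv ℝ f)) V :=
    hfd.continuousOn_fderiv_of_isOpen hV le_rfl
  have hgd : ContDiff ℝ 1 (fderiv ℝ g) := hg.fderiv_right (by norm_num)
  have hgdd : Continuous (fderiv ℝ (fderiv ℝ g)) := hgd.continuous_fderiv (by norm_num)
  have key : ∀ v : 𝔼, Integrable (fun x => f x * fderiv ℝ (fderiv ℝ g) x v v) ∧
      Integrable (fun x => fderiv ℝ (fderiv ℝ f) x v v * g x) ∧
      ∫ x, f x * fderiv ℝ (fderiv ℝ g) x v v = ∫ x, fderiv ℝ (fderiv ℝ f) x v v * g x := by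
    intro v
    have hs1 : tsupport (fun x => fderiv ℝ g x v) ⊆ tsupport g := tsupport_fderiv_apply_subset ℝ v
    have e2 : ∀ x, fderiv ℝ (fun x => fderiv ℝ g x v) x v = fderiv ℝ (fderiv ℝ g) x v v := by
      intro x
      have h := (hgd.differentiable (by norm_num) x).hasFDerivAt.clm_apply (hasFDerivAt_const v x)
      rw [h.fderiv]
      simp
    have e3 : ∀ x ∈ V, fderiv ℝ (fun x => fderiv ℝ f x v) x v = fderiv ℝ (fderiv ℝ f) x v v := by
      intro x hx
      have h := ((hfd.contDiffAt (hV.mem_nhds hx)).differentiableAt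
        (by norm_num)).hasFDerivAt.clm_apply (hasFDerivAt_const v x)
      rw [h.fderiv]
      simp
    have hs2 : tsupport (fun x => fderiv ℝ (fderiv ℝ g) x v v) ⊆ tsupport g := by
      simp only [← e2]
      exact (tsupport_fderiv_apply_subset ℝ v).trans hs1
    have c1 : HasCompactSupport (fun x => fderiv ℝ g x v) :=
      IsCompact.of_isClosed_subset hgc (isClosed_tsupport _) hs1
    have c2 : HasCompactSupport (fun x => fderiv ℝ (fderiv ℝ g) x v v) :=
      IsCompact.of_isClosed_subset hgc (isClosed_tsupport _) hs2
    have hgv : Continuous (fun x => fderiv ℝ g x v) := hgd.continuous.clm_apply continuous_const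
    have i1 : Integrable (fun x => f x * fderiv ℝ (fderiv ℝ g) x v v) :=
      integrable_mul_of_tsupport_subset hV hf.continuousOn
        ((hgdd.clm_apply continuous_const).clm_apply continuous_const) c2 (hs2.trans hgV)
    have i2 : Integrable (fun x => fderiv ℝ f x v * fderiv ℝ g x v) :=
      integrable_mul_of_tsupport_subset hV (hfd.continuousOn.clm_apply continuousOn_const)
        hgv c1 (hs1.trans hgV)
    have i3 : Integrable (fun x => fderiv ℝ (fderiv ℝ f) x v v * g x) :=
      integrable_mul_of_tsupport_subset hV
        ((hfdd.clm_apply continuousOn_const).clm_apply continuousOn_const) hg.continuous hgc hgV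
    have i4 : Integrable (fun x => f x * fderiv ℝ g x v) :=
      integrable_mul_of_tsupport_subset hV hf.continuousOn hgv c1 (hs1.trans hgV)
    have i5 : Integrable (fun x => fderiv ℝ f x v * g x) :=
      integrable_mul_of_tsupport_subset hV (hfd.continuousOn.clm_apply continuousOn_const)
        hg.continuous hgc hgV
    -- Off `V` the second derivatives of `f` carry no information, but there the factor `g`
    -- vanishes.
    have e4 : ∀ x, fderiv ℝ (fun x => fderiv ℝ f x v) x v * g x =
        fderiv ℝ (fderiv ℝ f) x v v * g x := by
      intro x
      by_cases hx : x ∈ tsupport g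
      · rw [e3 x (hgV hx)]
      · simp [image_eq_zero_of_notMem_tsupport hx]
    refine ⟨i1, i3, ?_⟩
    have s1 := integral_mul_fderiv_eq_neg_fderiv_mul_of_integrable (μ := volume) (f := f)
      (g := fun x => fderiv ℝ g x v) (v := v) i2 (by simpa only [e2] using i1) i4
      (fun x hx => (hf.contDiffAt (hV.mem_nhds (hgV (hs1 hx)))).differentiableAt (by norm_num))
      (fun x _ => (hgd.differentiable (by norm_num) x).clm_apply (differentiableAt_const v))
    have s2 := integral_mul_fderiv_eq_neg_fderiv_mul_of_integrable (μ := volume)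
      (f := fun x => fderiv ℝ f x v) (g := g) (v := v) (by simpa only [e4] using i3) i2 i5
      (fun x hx => ((hfd.contDiffAt (hV.mem_nhds (hgV hx))).differentiableAt
        (by norm_num)).clm_apply (differentiableAt_const v))
      (fun x _ => hg.differentiable (by norm_num) x)
    simp only [e2] at s1
    simp only [e4] at s2
    rw [s1, s2, neg_neg]
  simp only [laplacian_eq_bilinTrace, bilinTrace_apply, Finset.mul_sum, Finset.sum_mul]
  rw [integral_finsetSum _ fun i _ => (key _).1, integral_finsetSum _ fun i _ => (key _).2.1]
  exact Finset.sum_congr rfl fun i _ => (key _).2.2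

lemma integral_mul_iterLaplacian {f g : 𝔼 → ℝ} {V : Set 𝔼} (hV : IsOpen V) {m : ℕ}
    (hf : ContDiffOn ℝ ((2 * m : ℕ) : WithTop ℕ∞) f V) (hg : ContDiff ℝ ∞ g)
    (hgc : HasCompactSupport g) (hgV : tsupport g ⊆ V) :
    ∫ x, f x * iterLaplacian m g x = ∫ x, iterLaplacian m f x * g x := by
  induction m generalizing f with
  | zero => rfl
  | succ m ih =>
    rw [iterLaplacian_succ, iterLaplacian_succ',
      integral_mul_laplacian hV (hf.of_le (by exact_mod_cast (by omega : 2 ≤ 2 * (m + 1))))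
        ((hg.iterLaplacian m).of_le two_le_infty)
        (hgc.iterLaplacian m) ((tsupport_iterLaplacian_subset g m).trans hgV)]
    refine ih fun x hx => (ContDiffAt.laplacian ?_).contDiffWithinAt
    convert! hf.contDiffAt (hV.mem_nhds hx) using 1

end LaplacianBasics

/-! ### The Laplacian on radial functions and on powers of the norm -/

section RadialCalculus

set_option maxSynthPendingDepth 3

open MeasureTheory

variable {n : ℕ}

local notation "𝔼" => EuclideanSpace ℝ (Fin n)

/-- The action of the Laplacian of `ℝⁿ` on functions of `s = ‖x‖²`. -/
noncomputable def radialLap (n : ℕ) (f : ℝ → ℝ) (s : ℝ) : ℝ :=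
  4 * s * deriv (deriv f) s + 2 * n * deriv f s

lemma hasFDerivAt_radial {f : ℝ → ℝ} {f' : ℝ} {a x : 𝔼} (hf : HasDerivAt f f' (‖x - a‖ ^ 2)) :
    HasFDerivAt (fun y => f (‖y - a‖ ^ 2)) ((2 * f') • innerSL ℝ (x - a)) x := by
  have h1 : HasFDerivAt (fun y : 𝔼 => ‖y - a‖ ^ 2) (2 • innerSL ℝ (x - a)) x := by
    simpa using ((hasFDerivAt_id x).sub_const a).norm_sq
  refine (hf.comp_hasFDerivAt x h1).congr_fderiv ?_
  ext v
  simp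
  ring

/-- With `z = x - a`, the Hessian is `2 f' I + 4 f'' z ⊗ z`, whose trace is `2 n f' + 4 ‖z‖² f''`.
-/
lemma laplacian_radial {f : ℝ → ℝ} {a x : 𝔼} (hf : ContDiffAt ℝ 2 f (‖x - a‖ ^ 2)) :
    Laplacian.laplacian (fun y => f (‖y - a‖ ^ 2)) x = radialLap n f (‖x - a‖ ^ 2) := by
  have hev : ∀ᶠ y in 𝓝 x, ContDiffAt ℝ 2 f (‖y - a‖ ^ 2) :=
    (Continuous.tendsto (f := fun y : 𝔼 => ‖y - a‖ ^ 2) (by fun_prop) x).eventually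
      (hf.eventually (by simp))
  have h1 : fderiv ℝ (fun y => f (‖y - a‖ ^ 2)) =ᶠ[𝓝 x]
      fun y => (2 * deriv f (‖y - a‖ ^ 2)) • innerSL ℝ (y - a) := by
    filter_upwards [hev] with y hy
    exact (hasFDerivAt_radial (hy.differentiableAt (by norm_num)).hasDerivAt).fderiv
  have hd : HasDerivAt (deriv f) (deriv (deriv f) (‖x - a‖ ^ 2)) (‖x - a‖ ^ 2) :=
    ((hf.derivWithin (m := 1) (by norm_num)).differentiableAt (by norm_num)).hasDerivAt
  have h2 : HasFDerivAt (fun y => innerSL ℝ (y - a)) (innerSL ℝ (E := 𝔼)) x :=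
    (innerSL ℝ (E := 𝔼)).hasFDerivAt.comp x ((hasFDerivAt_id x).sub_const a)
  have h3 := ((hasFDerivAt_radial hd).const_mul 2).smul h2
  rw [laplacian_eq_bilinTrace]
  simp only []
  rw [h1.fderiv_eq, HasFDerivAt.fderiv (f := fun y : 𝔼 => (2 * deriv f (‖y - a‖ ^ 2)) •
    innerSL ℝ (y - a)) h3, bilinTrace_apply]
  have e1 : ∀ v : 𝔼, innerSL ℝ v v = ‖v‖ ^ 2 := fun v => by simp
  have hp : ∑ i, inner ℝ (x - a) (EuclideanSpace.basisFun (Fin n) ℝ i) ^ 2 = ‖x - a‖ ^ 2 := by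
    rw [← OrthonormalBasis.sum_sq_norm_inner_left (EuclideanSpace.basisFun (Fin n) ℝ) (x - a)]
    simp
  have e2 : ∀ i, 2 * deriv f (‖x - a‖ ^ 2) * 1 ^ 2 +
      2 * (2 * deriv (deriv f) (‖x - a‖ ^ 2) *
        inner ℝ (x - a) (EuclideanSpace.basisFun (Fin n) ℝ i)) *
          inner ℝ (x - a) (EuclideanSpace.basisFun (Fin n) ℝ i) = 2 * deriv f (‖x - a‖ ^ 2) +
        4 * deriv (deriv f) (‖x - a‖ ^ 2) *
          inner ℝ (x - a) (EuclideanSpace.basisFun (Fin n) ℝ i) ^ 2 := fun i => by ring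
  simp only [add_apply, smul_apply, e1, ContinuousLinearMap.smulRight_apply,
    OrthonormalBasis.norm_eq_one, innerSL_apply_apply, smul_eq_mul, e2]
  rw [Finset.sum_add_distrib, ← Finset.mul_sum, ← Finset.mul_sum, hp]
  simp [radialLap]
  ring

lemma contDiff_deriv_infty {f : ℝ → ℝ} (hf : ContDiff ℝ ∞ f) : ContDiff ℝ ∞ (deriv f) :=
  (contDiff_infty_iff_deriv.1 hf).2

lemma ContDiff.radialLap {f : ℝ → ℝ} (hf : ContDiff ℝ ∞ f) (n : ℕ) :
    ContDiff ℝ ∞ (radialLap n f) := by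
  have h1 := contDiff_deriv_infty hf
  have h2 := contDiff_deriv_infty h1
  unfold _root_.radialLap
  fun_prop

lemma ContDiff.iterate_radialLap {f : ℝ → ℝ} (hf : ContDiff ℝ ∞ f) (n m : ℕ) :
    ContDiff ℝ ∞ ((_root_.radialLap n)^[m] f) := by
  induction m with
  | zero => exact hf
  | succ m ih => rw [Function.iterate_succ_apply']; exact ih.radialLap n

lemma iterLaplacian_radial {f : ℝ → ℝ} (hf : ContDiff ℝ ∞ f) (a : 𝔼) (m : ℕ) :
    iterLaplacian m (fun y => f (‖y - a‖ ^ 2)) = fun x => (radialLap n)^[m] f (‖x - a‖ ^ 2) := by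
  induction m with
  | zero => rfl
  | succ m ih =>
    rw [iterLaplacian_succ, ih]
    ext x
    rw [Function.iterate_succ_apply']
    exact laplacian_radial ((hf.iterate_radialLap n m).contDiffAt.of_le two_le_infty)

lemma contDiff_radial {f : ℝ → ℝ} (hf : ContDiff ℝ ∞ f) (a : 𝔼) :
    ContDiff ℝ ∞ (fun y => f (‖y - a‖ ^ 2)) :=
  hf.comp ((contDiff_id.sub contDiff_const).norm_sq ℝ)

lemma contDiffAt_norm_zpow {r : WithTop ℕ∞} (k : ℤ) {x : 𝔼} (hx : x ≠ 0) :
    ContDiffAt ℝ r (fun y : 𝔼 => ‖y‖ ^ k) x := by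
  simp only [← Real.rpow_intCast]
  exact (contDiffAt_norm ℝ hx).rpow_const_of_ne (by simpa using hx)

lemma laplacian_norm_zpow (k : ℤ) {x : 𝔼} (hx : x ≠ 0) :
    Laplacian.laplacian (fun y : 𝔼 => ‖y‖ ^ k) x = k * (k + n - 2) * ‖x‖ ^ (k - 2) := by
  set p : ℝ := k / 2
  have hpow : ∀ y : 𝔼, ∀ q : ℤ, ‖y‖ ^ q = (‖y‖ ^ 2) ^ ((q : ℝ) / 2) := by
    intro y q
    rw [← Real.rpow_natCast, ← Real.rpow_mul (norm_nonneg _), ← Real.rpow_intCast]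
    congr 1
    push_cast
    ring
  have hs : 0 < ‖x‖ ^ 2 := by positivity
  have h0 : (fun y : 𝔼 => ‖y‖ ^ k) = fun y => (fun s : ℝ => s ^ p) (‖y - 0‖ ^ 2) := by
    ext y
    simp only [sub_zero]
    exact hpow y k
  rw [h0, laplacian_radial (f := fun s : ℝ => s ^ p) (by
    simpa using Real.contDiffAt_rpow_const_of_ne hs.ne')]
  have hd1 : ∀ s : ℝ, 0 < s → deriv (fun s : ℝ => s ^ p) s = p * s ^ (p - 1) := fun s hs =>
    (Real.hasDerivAt_rpow_const (Or.inl hs.ne')).deriv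
  have hd2 : deriv (deriv (fun s : ℝ => s ^ p)) (‖x‖ ^ 2) =
      p * ((p - 1) * (‖x‖ ^ 2) ^ (p - 1 - 1)) := by
    have hev : deriv (fun s : ℝ => s ^ p) =ᶠ[𝓝 (‖x‖ ^ 2)] fun s => p * s ^ (p - 1) := by
      filter_upwards [lt_mem_nhds hs] with s hs using hd1 s hs
    rw [hev.deriv_eq]
    exact ((Real.hasDerivAt_rpow_const (Or.inl hs.ne')).const_mul p).deriv
  simp only [sub_zero, radialLap, hd2, hd1 _ hs]
  have h3 : ‖x‖ ^ 2 * (‖x‖ ^ 2) ^ (p - 1 - 1) = (‖x‖ ^ 2) ^ (p - 1) := by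
    rw [Real.rpow_sub_one hs.ne' (p - 1)]
    field_simp
  have h4 : ‖x‖ ^ (k - 2) = (‖x‖ ^ 2) ^ (p - 1) := by
    rw [hpow]
    congr 1
    push_cast
    ring
  rw [h4, ← h3]
  have hk : (k : ℝ) = 2 * p := by ring
  rw [hk]
  have h5 : 4 * ‖x‖ ^ 2 * (p * ((p - 1) * (‖x‖ ^ 2) ^ (p - 1 - 1))) =
      4 * (p * (p - 1)) * (‖x‖ ^ 2 * (‖x‖ ^ 2) ^ (p - 1 - 1)) := by ring
  rw [h5, h3]
  ring

lemma iterLaplacian_norm_zpow (k : ℤ) (j : ℕ) {x : 𝔼} (hx : x ≠ 0) :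
    iterLaplacian j (fun y : 𝔼 => ‖y‖ ^ k) x =
      (∏ i ∈ Finset.range j, ((k : ℝ) - 2 * i) * (k - 2 * i + n - 2)) * ‖x‖ ^ (k - 2 * j) := by
  induction j generalizing x with
  | zero => simp [iterLaplacian_zero]
  | succ j ih =>
    have hev : iterLaplacian j (fun y : 𝔼 => ‖y‖ ^ k) =ᶠ[𝓝 x]
        (∏ i ∈ Finset.range j, ((k : ℝ) - 2 * i) * (k - 2 * i + n - 2)) •
          fun y : 𝔼 => ‖y‖ ^ (k - 2 * j) := by
      filter_upwards [isOpen_ne.mem_nhds hx] with y hy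
      exact ih hy
    rw [iterLaplacian_succ, (InnerProductSpace.laplacian_congr_nhds hev).eq_of_nhds,
      InnerProductSpace.laplacian_smul, laplacian_norm_zpow _ hx, Finset.prod_range_succ,
      smul_eq_mul]
    · push_cast
      rw [show k - 2 * (j : ℤ) - 2 = k - 2 * (j + 1) by ring]
      ring
    · exact contDiffAt_norm_zpow _ hx

lemma laplacian_log_norm_sq (a : EuclideanSpace ℝ (Fin 2)) {x : EuclideanSpace ℝ (Fin 2)}
    (hx : x ≠ a) : Laplacian.laplacian (fun y => Real.log (‖y - a‖ ^ 2)) x = 0 := by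
  have hs : ‖x - a‖ ^ 2 ≠ 0 := by simpa [sub_eq_zero] using hx
  rw [laplacian_radial (Real.contDiffAt_log.2 hs), radialLap, Real.deriv_log', deriv_inv]
  push_cast
  field_simp
  ring

end RadialCalculus

/-! ### Radial kernels whose dilation derivative is an iterated Laplacian -/

section RadialKernels

set_option maxSynthPendingDepth 3

open MeasureTheory

variable {n : ℕ}

local notation "𝔼" => EuclideanSpace ℝ (Fin n)

/-- Smooth functions on `ℝ` vanishing on `[1, ∞)`. As functions of `‖x‖²` they are test functions
supported in the closed unit ball. -/
structure IsRadialProfile (f : ℝ → ℝ) : Prop where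
  contDiff : ContDiff ℝ ∞ f
  eq_zero : ∀ s, 1 ≤ s → f s = 0

/-- The operator on functions of `s = ‖x‖²` corresponding to `g ↦ div (x g)`. -/
noncomputable def radialEuler (n : ℕ) (g : ℝ → ℝ) (s : ℝ) : ℝ := n * g s + 2 * s * deriv g s

lemma ContDiff.differentiable_infty {f : ℝ → ℝ} (hf : ContDiff ℝ ∞ f) : Differentiable ℝ f :=
  hf.differentiable (by simp)

namespace IsRadialProfile

variable {f g : ℝ → ℝ}

lemma deriv (hf : IsRadialProfile f) : IsRadialProfile (deriv f) := by
  refine ⟨contDiff_deriv_infty hf.contDiff, fun s hs => ?_⟩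
  have hcl : IsClosed {s : ℝ | _root_.deriv f s = 0} :=
    isClosed_eq (contDiff_deriv_infty hf.contDiff).continuous continuous_const
  have hsub : Ioi (1 : ℝ) ⊆ {s : ℝ | _root_.deriv f s = 0} := by
    intro t ht
    have h : f =ᶠ[𝓝 t] fun _ => 0 := by
      filter_upwards [Ioi_mem_nhds ht] with r hr using hf.eq_zero r (le_of_lt hr)
    simp [h.deriv_eq]
  have := hcl.closure_subset_iff.2 hsub
  rw [closure_Ioi] at this
  exact this hs

lemma radialEuler (hf : IsRadialProfile f) (n : ℕ) : IsRadialProfile (radialEuler n f) := by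
  have h1 := hf.deriv.contDiff
  have h0 := hf.contDiff
  refine ⟨?_, fun s hs => ?_⟩
  · unfold _root_.radialEuler
    fun_prop
  · simp [_root_.radialEuler, hf.eq_zero s hs, hf.deriv.eq_zero s hs]

lemma add_const_mul (hf : IsRadialProfile f) (hg : IsRadialProfile g) (c : ℝ) :
    IsRadialProfile (fun s => f s + c * g s) :=
  ⟨hf.contDiff.add (contDiff_const.mul hg.contDiff), fun s hs => by
    simp [hf.eq_zero s hs, hg.eq_zero s hs]⟩

/-- Integrating from `1` keeps the primitive zero on `[1, ∞)`. Because `Δ = div ∇` and `∇ f(‖x‖²) =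
2 f' x`, this solves `radialLap n f = radialEuler n g` within the profiles. -/
lemma exists_antideriv (hg : IsRadialProfile g) :
    ∃ f, IsRadialProfile f ∧ (fun s => 2 * _root_.deriv f s) = g := by
  have hd : ∀ s, HasDerivAt (fun s => (1 / 2) * ∫ t in (1 : ℝ)..s, g t) ((1 / 2) * g s) s :=
    fun s => (intervalIntegral.integral_hasDerivAt_right
      (hg.contDiff.continuous.intervalIntegrable _ _)
      (hg.contDiff.continuous.stronglyMeasurableAtFilter _ _)
      hg.contDiff.continuous.continuousAt).const_mul _
  have hd' : _root_.deriv (fun s => (1 / 2) * ∫ t in (1 : ℝ)..s, g t) = fun s => (1 / 2) * g s :=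
    funext fun s => (hd s).deriv
  refine ⟨fun s => (1 / 2) * ∫ t in (1 : ℝ)..s, g t, ⟨?_, fun s hs => ?_⟩, ?_⟩
  · rw [contDiff_infty_iff_deriv, hd']
    exact ⟨fun s => (hd s).differentiableAt, contDiff_const.mul hg.contDiff⟩
  · have : ∫ t in (1 : ℝ)..s, g t = ∫ t in (1 : ℝ)..s, (0 : ℝ) :=
      intervalIntegral.integral_congr fun t ht => by
        rw [uIcc_of_le hs] at ht
        exact hg.eq_zero t ht.1
    simp [this]
  · rw [hd']
    ext s
    ring

lemma hasCompactSupport (hf : IsRadialProfile f) (a : 𝔼) {c : ℝ} (hc : 0 < c) :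
    HasCompactSupport (fun y : 𝔼 => f (‖c⁻¹ • (y - a)‖ ^ 2)) := by
  refine HasCompactSupport.intro (isCompact_closedBall a c) fun y hy => hf.eq_zero _ ?_
  rw [Metric.mem_closedBall, dist_eq_norm, not_le] at hy
  rw [norm_smul, norm_inv, Real.norm_of_nonneg hc.le, inv_mul_eq_div]
  exact one_le_pow₀ ((one_le_div hc).2 hy.le)

lemma hasCompactSupport_norm_sq (hf : IsRadialProfile f) :
    HasCompactSupport (fun y : 𝔼 => f (‖y‖ ^ 2)) := by
  simpa using hf.hasCompactSupport (0 : 𝔼) one_pos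

lemma continuous_norm_sq (hf : IsRadialProfile f) : Continuous (fun y : 𝔼 => f (‖y‖ ^ 2)) :=
  hf.contDiff.continuous.comp (by fun_prop)

lemma integrable_norm_sq (hf : IsRadialProfile f) : Integrable (fun y : 𝔼 => f (‖y‖ ^ 2)) :=
  hf.continuous_norm_sq.integrable_of_hasCompactSupport hf.hasCompactSupport_norm_sq

/-- The integral of the divergence of a compactly supported field. -/
lemma integral_radialEuler (hg : IsRadialProfile g) :
    ∫ y : 𝔼, _root_.radialEuler n g (‖y‖ ^ 2) = 0 := by
  have hfd : ∀ y : 𝔼, HasFDerivAt (fun y : 𝔼 => g (‖y‖ ^ 2))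
      ((2 * _root_.deriv g (‖y‖ ^ 2)) • innerSL ℝ y) y := by
    intro y
    have h := hasFDerivAt_radial (n := n) (a := 0) (x := y)
      (hg.contDiff.differentiable_infty (‖y - 0‖ ^ 2)).hasDerivAt
    simpa using h
  have hc : Continuous (fun y : 𝔼 => _root_.deriv g (‖y‖ ^ 2)) := hg.deriv.continuous_norm_sq
  have hcs : HasCompactSupport (fun y : 𝔼 => _root_.deriv g (‖y‖ ^ 2)) :=
    hg.deriv.hasCompactSupport_norm_sq
  have hint : ∀ i : Fin n, Integrable (fun y : 𝔼 => y i * (2 * _root_.deriv g (‖y‖ ^ 2) * y i)) :=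
    fun i => Continuous.integrable_of_hasCompactSupport (by fun_prop)
      ((hcs.mul_left (f := fun _ => 2)).mul_right.mul_left)
  -- One integration by parts of `y_i ∂_i g` per coordinate; the `n` copies of `-∫ g` cancel the
  -- term `n g`.
  have key : ∀ i : Fin n, ∫ y : 𝔼, y i * (2 * _root_.deriv g (‖y‖ ^ 2) * y i) =
      -∫ y : 𝔼, g (‖y‖ ^ 2) := by
    intro i
    have hv : ∀ y : 𝔼, fderiv ℝ (fun y : 𝔼 => g (‖y‖ ^ 2)) y (EuclideanSpace.single i 1) =
        2 * _root_.deriv g (‖y‖ ^ 2) * y i := by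
      intro y
      rw [(hfd y).fderiv]
      simp [EuclideanSpace.inner_single_right]
    have hu : ∀ y : 𝔼, fderiv ℝ (fun y : 𝔼 => y i) y (EuclideanSpace.single i 1) = 1 := by
      intro y
      rw [HasFDerivAt.fderiv (f := fun y : 𝔼 => y i)
        (EuclideanSpace.proj (𝕜 := ℝ) i : 𝔼 →L[ℝ] ℝ).hasFDerivAt]
      simp
    have h := integral_mul_fderiv_eq_neg_fderiv_mul_of_integrable (μ := (volume : Measure 𝔼))
      (f := fun y : 𝔼 => y i) (g := fun y : 𝔼 => g (‖y‖ ^ 2)) (v := EuclideanSpace.single i 1)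
      (by simpa only [hu, one_mul] using hg.integrable_norm_sq) (by simpa only [hv] using hint i)
      (Continuous.integrable_of_hasCompactSupport
        ((by fun_prop : Continuous fun y : 𝔼 => y i).mul hg.continuous_norm_sq)
        hg.hasCompactSupport_norm_sq.mul_left)
      (fun y _ => (EuclideanSpace.proj (𝕜 := ℝ) i : 𝔼 →L[ℝ] ℝ).differentiableAt)
      (fun y _ => (hfd y).differentiableAt)
    simpa only [hv, hu, one_mul] using h
  have hsum : ∀ y : 𝔼, _root_.radialEuler n g (‖y‖ ^ 2) =
      n * g (‖y‖ ^ 2) + ∑ i, y i * (2 * _root_.deriv g (‖y‖ ^ 2) * y i) := by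
    intro y
    have : ∀ i, y i * (2 * _root_.deriv g (‖y‖ ^ 2) * y i) =
        2 * _root_.deriv g (‖y‖ ^ 2) * y i ^ 2 := fun i => by ring
    simp only [this]
    rw [← Finset.mul_sum, ← EuclideanSpace.real_norm_sq_eq, _root_.radialEuler]
    ring
  simp only [hsum]
  rw [integral_add (hg.integrable_norm_sq.const_mul _) (integrable_finsetSum _ fun i _ => hint i),
    integral_finsetSum _ fun i _ => hint i, integral_const_mul]
  simp [key]

end IsRadialProfile

lemma radialLap_eq_radialEuler {f : ℝ → ℝ} (hf : ContDiff ℝ ∞ f) :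
    radialLap n f = radialEuler n (fun s => 2 * deriv f s) := by
  ext s
  rw [radialLap, radialEuler, deriv_const_mul _ ((contDiff_deriv_infty hf).differentiable_infty s)]
  ring

lemma radialLap_add_const_mul {f g : ℝ → ℝ} (hf : ContDiff ℝ ∞ f) (hg : ContDiff ℝ ∞ g) (c : ℝ) :
    radialLap n (fun s => f s + c * g s) = fun s => radialLap n f s + c * radialLap n g s := by
  have h1 : ∀ {f g : ℝ → ℝ}, ContDiff ℝ ∞ f → ContDiff ℝ ∞ g →
      deriv (fun s => f s + c * g s) = fun s => deriv f s + c * deriv g s := by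
    intro f g hf hg
    ext s
    exact ((hf.differentiable_infty s).hasDerivAt.add
      ((hg.differentiable_infty s).hasDerivAt.const_mul c)).deriv
  ext s
  simp only [radialLap, h1 hf hg, h1 (contDiff_deriv_infty hf) (contDiff_deriv_infty hg)]
  ring

lemma radialEuler_add_const_mul {f g : ℝ → ℝ} (hf : ContDiff ℝ ∞ f) (hg : ContDiff ℝ ∞ g) (c : ℝ) :
    radialEuler n (fun s => f s + c * g s) =
      fun s => radialEuler n f s + c * radialEuler n g s := by
  ext s
  have h1 : deriv (fun s => f s + c * g s) s = deriv f s + c * deriv g s :=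
    ((hf.differentiable_infty s).hasDerivAt.add
      ((hg.differentiable_infty s).hasDerivAt.const_mul c)).deriv
  simp only [radialEuler, h1]
  ring

lemma ContDiff.radialEuler {f : ℝ → ℝ} (hf : ContDiff ℝ ∞ f) (n : ℕ) :
    ContDiff ℝ ∞ (radialEuler n f) := by
  have h1 := contDiff_deriv_infty hf
  unfold _root_.radialEuler
  fun_prop

/-- The commutator `[Δ, x·∇] = 2Δ`, expressing that `Δ` is homogeneous of degree `-2`. -/
lemma radialLap_radialEuler {g : ℝ → ℝ} (hg : ContDiff ℝ ∞ g) :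
    radialLap n (radialEuler n g) =
      fun s => radialEuler n (radialLap n g) s + 2 * radialLap n g s := by
  have h1 := contDiff_deriv_infty hg
  have h2 := contDiff_deriv_infty h1
  have d0 := fun s => (hg.differentiable_infty s).hasDerivAt
  have d1 := fun s => (h1.differentiable_infty s).hasDerivAt
  have d2 := fun s => (h2.differentiable_infty s).hasDerivAt
  have e1 : deriv (radialEuler n g) =
      fun s => (n + 2) * deriv g s + 2 * s * deriv (deriv g) s := by
    ext s
    refine (((d0 s).const_mul (n : ℝ)).add
      (((hasDerivAt_id' s).const_mul 2).mul (d1 s))).deriv.trans ?_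
    ring
  have e2 : ∀ s, deriv (deriv (radialEuler n g)) s =
      (n + 4) * deriv (deriv g) s + 2 * s * deriv (deriv (deriv g)) s := by
    intro s
    rw [e1]
    refine (((d1 s).const_mul ((n : ℝ) + 2)).add
      (((hasDerivAt_id' s).const_mul 2).mul (d2 s))).deriv.trans ?_
    ring
  have e3 : ∀ s, deriv (radialLap n g) s =
      (4 + 2 * n) * deriv (deriv g) s + 4 * s * deriv (deriv (deriv g)) s := by
    intro s
    refine ((((hasDerivAt_id' s).const_mul 4).mul (d2 s)).add
      ((d1 s).const_mul (2 * n : ℝ))).deriv.trans ?_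
    ring
  ext s
  rw [radialLap, e2, e1, radialEuler, e3]
  simp only [radialLap]
  ring

lemma iterate_radialLap_radialEuler {g : ℝ → ℝ} (hg : ContDiff ℝ ∞ g) (m : ℕ) :
    (radialLap n)^[m] (radialEuler n g) = fun s =>
      radialEuler n ((radialLap n)^[m] g) s + (2 * m : ℕ) * (radialLap n)^[m] g s := by
  induction m with
  | zero => simp
  | succ m ih =>
    have h := hg.iterate_radialLap n m
    rw [Function.iterate_succ_apply', ih, radialLap_add_const_mul (h.radialEuler n) h,
      radialLap_radialEuler h, Function.iterate_succ_apply']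
    ext s
    push_cast
    ring

/-- There is a smooth radial kernel `k` whose dilation derivative is an `m`-fold Laplacian of a
test function, with nonzero integral. -/
lemma exists_radialEuler_eq_iterate_radialLap {m : ℕ} (hm : 1 ≤ m) {g : ℝ → ℝ}
    (hg : IsRadialProfile g) : ∃ f k : ℝ → ℝ, ∃ a : ℝ, IsRadialProfile f ∧ IsRadialProfile k ∧
      a ≠ 0 ∧ radialEuler n k = (radialLap n)^[m] f ∧
      ∫ y : 𝔼, k (‖y‖ ^ 2) = a * ∫ y : 𝔼, g (‖y‖ ^ 2) := by
  induction m, hm using Nat.le_induction with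
  | base =>
    obtain ⟨f, hf, hfg⟩ := hg.exists_antideriv
    refine ⟨f, g, 1, hf, hg, one_ne_zero, ?_, by simp⟩
    rw [Function.iterate_one, radialLap_eq_radialEuler hf.contDiff, hfg]
  | succ m hm ih =>
    obtain ⟨f, k, a, hf, hk, ha, hkf, hI⟩ := ih
    obtain ⟨f₁, hf₁, hff⟩ := hf.exists_antideriv
    -- Write `E` for `radialEuler n`. With `Δ f₁ = E f`, the commutator gives `Δ^(m+1) f₁ = E Δ^m f
    -- + 2m Δ^m f = E (E k + 2m k)`. In the new kernel `E k` integrates to zero, so the integral is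
    -- multiplied by `2m ≠ 0`.
    refine ⟨f₁, fun s => radialEuler n k s + (2 * m : ℕ) * k s, (2 * m : ℕ) * a, hf₁,
      (hk.radialEuler n).add_const_mul hk _, mul_ne_zero (by positivity) ha, ?_, ?_⟩
    · rw [Function.iterate_succ_apply, radialLap_eq_radialEuler hf₁.contDiff, hff,
        iterate_radialLap_radialEuler hf.contDiff, ← hkf,
        radialEuler_add_const_mul (hk.contDiff.radialEuler n) hk.contDiff]
    · rw [integral_add (hk.radialEuler n).integrable_norm_sq
        (hk.integrable_norm_sq.const_mul _), hk.integral_radialEuler, integral_const_mul, hI]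
      ring

lemma exists_radial_kernel {m : ℕ} (hm : 1 ≤ m) :
    ∃ f k : ℝ → ℝ, IsRadialProfile f ∧ IsRadialProfile k ∧
      radialEuler n k = (radialLap n)^[m] f ∧ ∫ y : 𝔼, k (‖y‖ ^ 2) ≠ 0 := by
  have hg : IsRadialProfile (fun s => Real.smoothTransition (1 - s)) :=
    ⟨Real.smoothTransition.contDiff.comp (contDiff_const.sub contDiff_id), fun s hs =>
      Real.smoothTransition.zero_of_nonpos (by linarith)⟩
  have hpos : 0 < ∫ y : 𝔼, Real.smoothTransition (1 - ‖y‖ ^ 2) := by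
    refine hg.continuous_norm_sq.integral_pos_of_hasCompactSupport_nonneg_nonzero
      hg.hasCompactSupport_norm_sq (fun y => Real.smoothTransition.nonneg _) (x := 0) ?_
    exact (Real.smoothTransition.pos_of_pos (by simp)).ne'
  obtain ⟨f, k, a, hf, hk, ha, hkf, hI⟩ := exists_radialEuler_eq_iterate_radialLap (n := n) hm hg
  exact ⟨f, k, hf, hk, hkf, by rw [hI]; exact mul_ne_zero ha hpos.ne'⟩

end RadialKernels

/-! ### Weak solutions with a point singularity: Dirac mass and its coefficient -/

section WeakSolutions

set_option maxSynthPendingDepth 3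

open MeasureTheory

variable {n : ℕ}

local notation "𝔼" => EuclideanSpace ℝ (Fin n)

/-- `φ` is a test function on `V`. -/
structure IsTestOn (φ : 𝔼 → ℝ) (V : Set 𝔼) : Prop where
  contDiff : ContDiff ℝ ∞ φ
  hasCompactSupport : HasCompactSupport φ
  tsupport_subset : tsupport φ ⊆ V

namespace IsTestOn

lemma sub {φ ψ : 𝔼 → ℝ} {V : Set 𝔼} (hφ : IsTestOn φ V) (hψ : IsTestOn ψ V) :
    IsTestOn (fun x => φ x - ψ x) V :=
  ⟨hφ.contDiff.sub hψ.contDiff, hφ.hasCompactSupport.sub hψ.hasCompactSupport,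
    (tsupport_sub φ ψ).trans (union_subset hφ.tsupport_subset hψ.tsupport_subset)⟩

lemma const_mul {φ : 𝔼 → ℝ} {V : Set 𝔼} (hφ : IsTestOn φ V) (c : ℝ) : IsTestOn (fun x => c * φ x) V :=
  ⟨contDiff_const.mul hφ.contDiff, hφ.hasCompactSupport.mul_left,
    (closure_mono (Function.support_mul_subset_right _ φ)).trans hφ.tsupport_subset⟩

lemma exists_iteratedFDeriv_bound {φ : 𝔼 → ℝ} {V : Set 𝔼} (hφ : IsTestOn φ V) (N : ℕ) :
    ∃ M, 0 ≤ M ∧ ∀ i ≤ N, ∀ x, ‖iteratedFDeriv ℝ i φ x‖ ≤ M := by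
  have h : ∀ i : ℕ, ∃ C, ∀ x, ‖iteratedFDeriv ℝ i φ x‖ ≤ C := fun i =>
    (hφ.hasCompactSupport.iteratedFDeriv i).exists_bound_of_continuous
      (hφ.contDiff.continuous_iteratedFDeriv (by exact_mod_cast le_top))
  choose C hC using h
  have hC0 : ∀ i, 0 ≤ C i := fun i => (norm_nonneg _).trans (hC i 0)
  refine ⟨∑ i ∈ Finset.range (N + 1), C i, Finset.sum_nonneg fun i _ => hC0 i, fun i hi x => ?_⟩
  exact (hC i x).trans (Finset.single_le_sum (f := C) (fun j _ => hC0 j)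
    (Finset.mem_range.2 (by omega)))

end IsTestOn

lemma norm_iteratedFDeriv_comp_homothety {η : 𝔼 → ℝ} (hη : ContDiff ℝ ∞ η) (a : 𝔼) {c : ℝ}
    (hc : 0 ≤ c) (j : ℕ) (x : 𝔼) :
    ‖iteratedFDeriv ℝ j (fun y => η (c • (y - a))) x‖ =
      c ^ j * ‖iteratedFDeriv ℝ j η (c • (x - a))‖ := by
  rw [iteratedFDeriv_comp_sub (f := fun z => η (c • z)),
    iteratedFDeriv_comp_const_smul c (hη.of_le (by exact_mod_cast le_top)), norm_smul,
    Real.norm_of_nonneg (pow_nonneg hc j)]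

lemma natCast_le_infty (k : ℕ) : (k : WithTop ℕ∞) ≤ ∞ := by
  exact_mod_cast le_top

/-- By Leibniz, `2m` derivatives cost at most `ε^(-2m)`, and one power of `ε` is regained: a
derivative falling on `φ` does not hit the rescaled `η`, and if none falls on `φ`, then `φ a = 0`
makes `φ` itself `O(ε)`. -/
lemma exists_bound_iterLaplacian_mul {φ η : 𝔼 → ℝ} {V W : Set 𝔼} {a : 𝔼} (hφ : IsTestOn φ V)
    (hφa : φ a = 0) (hη : IsTestOn η W) (m : ℕ) :
    ∃ K, ∀ ε : ℝ, 0 < ε → ε ≤ 1 → ∀ y ∈ Metric.closedBall a ε,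
      |iterLaplacian m (fun z => φ z * η (ε⁻¹ • (z - a))) y| ≤ K * (ε / ε ^ (2 * m)) := by
  obtain ⟨M, hM0, hM⟩ := hφ.exists_iteratedFDeriv_bound (2 * m)
  obtain ⟨N, hN0, hN⟩ := hη.exists_iteratedFDeriv_bound (2 * m)
  obtain ⟨L, hL⟩ := ContDiff.lipschitzWith_of_hasCompactSupport hφ.hasCompactSupport hφ.contDiff
    (by simp)
  refine ⟨‖bilinTrace n‖ ^ m * ∑ i ∈ Finset.range (2 * m + 1), ((2 * m).choose i : ℝ) *
    ((M + L) * N), fun ε hε hε1 y hy => ?_⟩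
  have hηε : ContDiff ℝ ∞ (fun z => η (ε⁻¹ • (z - a))) := hη.contDiff.comp (by fun_prop)
  refine (abs_iterLaplacian_le (hφ.contDiff.mul hηε) m y).trans ?_
  rw [mul_assoc]
  refine mul_le_mul_of_nonneg_left ?_ (by positivity)
  refine (norm_iteratedFDeriv_mul_le hφ.contDiff hηε y (natCast_le_infty _)).trans ?_
  rw [Finset.sum_mul]
  refine Finset.sum_le_sum fun i hi => ?_
  have hi' : i ≤ 2 * m := by
    have := Finset.mem_range.1 hi
    omega
  rw [norm_iteratedFDeriv_comp_homothety hη.contDiff a (by positivity), mul_assoc, mul_assoc]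
  refine mul_le_mul_of_nonneg_left ?_ (by positivity)
  have h1 : ‖iteratedFDeriv ℝ i φ y‖ * ε ^ i ≤ (M + L) * ε := by
    -- For `i = 0` the factor `ε` comes from the Lipschitz bound at `a`; for `i ≥ 1` from `ε^i ≤ ε`.
    rcases Nat.eq_zero_or_pos i with rfl | hpos
    · have h := hL.dist_le_mul y a
      rw [dist_eq_norm, hφa, sub_zero] at h
      have hya : dist y a ≤ ε := hy
      rw [norm_iteratedFDeriv_zero, pow_zero, mul_one]
      calc ‖φ y‖ ≤ L * dist y a := h
        _ ≤ L * ε := mul_le_mul_of_nonneg_left hya L.2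
        _ ≤ (M + L) * ε := by nlinarith
    · calc ‖iteratedFDeriv ℝ i φ y‖ * ε ^ i ≤ M * ε :=
            mul_le_mul (hM i hi' y) (pow_le_of_le_one hε.le hε1 hpos.ne') (by positivity) hM0
        _ ≤ (M + L) * ε := by nlinarith [L.2, mul_nonneg L.2 hε.le]
  have h2 : (ε⁻¹) ^ (2 * m - i) = ε ^ i / ε ^ (2 * m) := by
    rw [inv_pow, eq_div_iff (by positivity), inv_mul_eq_iff_eq_mul₀ (by positivity), ← pow_add]
    congr 1
    omega
  rw [h2]
  have h3 := hN (2 * m - i) (by omega) (ε⁻¹ • (y - a))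
  calc ‖iteratedFDeriv ℝ i φ y‖ * (ε ^ i / ε ^ (2 * m) *
        ‖iteratedFDeriv ℝ (2 * m - i) η (ε⁻¹ • (y - a))‖)
      = (‖iteratedFDeriv ℝ i φ y‖ * ε ^ i) *
        ‖iteratedFDeriv ℝ (2 * m - i) η (ε⁻¹ • (y - a))‖ / ε ^ (2 * m) := by ring
    _ ≤ ((M + L) * ε) * N / ε ^ (2 * m) := by
        refine div_le_div_of_nonneg_right ?_ (by positivity)
        exact mul_le_mul h1 h3 (norm_nonneg _) (by have := L.2; positivity)
    _ = (M + L) * N * (ε / ε ^ (2 * m)) := by ring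

/-- The distribution `Δ^m U`. -/
noncomputable def weakIterLaplacian (m : ℕ) (U φ : 𝔼 → ℝ) : ℝ := ∫ y, U y * iterLaplacian m φ y

lemma Integrable.mul_of_hasCompactSupport {U ψ : 𝔼 → ℝ} (hU : Integrable U) (hψ : Continuous ψ)
    (hc : HasCompactSupport ψ) : Integrable (fun y => U y * ψ y) := by
  obtain ⟨C, hC⟩ := hc.exists_bound_of_continuous hψ
  exact hU.mul_bdd hψ.aestronglyMeasurable (ae_of_all _ hC)

lemma IsTestOn.integrable_mul_iterLaplacian {U φ : 𝔼 → ℝ} {V : Set 𝔼} (hφ : IsTestOn φ V)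
    (hU : Integrable U) (m : ℕ) : Integrable (fun y => U y * iterLaplacian m φ y) :=
  Integrable.mul_of_hasCompactSupport hU (hφ.contDiff.iterLaplacian m).continuous
    (hφ.hasCompactSupport.iterLaplacian m)

lemma weakIterLaplacian_sub {U φ ψ : 𝔼 → ℝ} {V W : Set 𝔼} (hU : Integrable U) (hφ : IsTestOn φ V)
    (hψ : IsTestOn ψ W) (m : ℕ) : weakIterLaplacian m U (fun x => φ x - ψ x) =
      weakIterLaplacian m U φ - weakIterLaplacian m U ψ := by
  unfold weakIterLaplacian
  rw [iterLaplacian_sub hφ.contDiff hψ.contDiff, ← integral_sub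
    (hφ.integrable_mul_iterLaplacian hU m) (hψ.integrable_mul_iterLaplacian hU m)]
  simp only [mul_sub]

lemma weakIterLaplacian_const_mul {φ : 𝔼 → ℝ} (U : 𝔼 → ℝ) (hφ : ContDiff ℝ ∞ φ) (c : ℝ) (m : ℕ) :
    weakIterLaplacian m U (fun x => c * φ x) = c * weakIterLaplacian m U φ := by
  unfold weakIterLaplacian
  rw [iterLaplacian_const_mul hφ, ← integral_const_mul]
  congr 1
  ext y
  ring

/-- If `U` solves `Δ^m U = 0` classically, it does so weakly. -/
lemma weakIterLaplacian_eq_zero_of_classical {U φ : 𝔼 → ℝ} {V : Set 𝔼} {m : ℕ} (hV : IsOpen V)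
    (hU : IsPolyharmonicOn m U V) (hφ : IsTestOn φ V) : weakIterLaplacian m U φ = 0 := by
  unfold weakIterLaplacian
  rw [integral_mul_iterLaplacian hV hU.1 hφ.contDiff hφ.hasCompactSupport hφ.tsupport_subset]
  refine integral_eq_zero_of_ae (ae_of_all _ fun x => ?_)
  by_cases hx : x ∈ tsupport φ
  · simp [hU.2 x (hφ.tsupport_subset hx)]
  · simp [image_eq_zero_of_notMem_tsupport hx]

lemma abs_integral_mul_le_of_closedBall {U ψ : 𝔼 → ℝ} {a : 𝔼} {ε C : ℝ} (hU : Integrable U)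
    (h0 : ∀ y ∉ Metric.closedBall a ε, ψ y = 0) (hC : ∀ y ∈ Metric.closedBall a ε, |ψ y| ≤ C) :
    |∫ y, U y * ψ y| ≤ C * ∫ y in Metric.closedBall a ε, |U y| := by
  rw [← setIntegral_eq_integral_of_forall_compl_eq_zero (μ := volume)
    (f := fun y => U y * ψ y) (s := Metric.closedBall a ε)
    (fun y hy => by rw [h0 y hy, mul_zero]), ← integral_const_mul, ← Real.norm_eq_abs]
  refine norm_integral_le_of_norm_le (hU.abs.const_mul C).integrableOn ?_
  refine (ae_restrict_iff' Metric.isClosed_closedBall.measurableSet).2 (ae_of_all _ fun y hy => ?_)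
  rw [norm_mul, mul_comm, Real.norm_eq_abs, Real.norm_eq_abs]
  exact mul_le_mul_of_nonneg_right (hC y hy) (abs_nonneg _)

/-- A smooth bump at the origin. -/
noncomputable def unitBump (n : ℕ) : ContDiffBump (0 : EuclideanSpace ℝ (Fin n)) :=
  ⟨1 / 2, 1, by norm_num, by norm_num⟩

lemma isTestOn_unitBump : IsTestOn (unitBump n : 𝔼 → ℝ) (Metric.closedBall 0 1) :=
  ⟨(unitBump n).contDiff, (unitBump n).hasCompactSupport, by rw [ContDiffBump.tsupport_eq]; rfl⟩

lemma tsupport_comp_homothety_subset {η : 𝔼 → ℝ} (hη : ∀ y, 1 < ‖y‖ → η y = 0) (a : 𝔼) {ε : ℝ}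
    (hε : 0 < ε) : tsupport (fun y => η (ε⁻¹ • (y - a))) ⊆ Metric.closedBall a ε := by
  refine closure_minimal (fun y hy => ?_) Metric.isClosed_closedBall
  by_contra h
  rw [Metric.mem_closedBall, dist_eq_norm, not_le] at h
  refine hy (hη _ ?_)
  rw [norm_smul, norm_inv, Real.norm_of_nonneg hε.le, inv_mul_eq_div]
  exact (one_lt_div hε).2 h

lemma IsTestOn.comp_homothety {η : 𝔼 → ℝ} (hη : IsTestOn η (Metric.closedBall 0 1)) (a : 𝔼) {ε : ℝ}
    (hε : 0 < ε) : IsTestOn (fun y => η (ε⁻¹ • (y - a))) (Metric.closedBall a ε) := by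
  have hs := tsupport_comp_homothety_subset (η := η) (fun y hy =>
    image_eq_zero_of_notMem_tsupport fun h => by
      have := hη.tsupport_subset h
      rw [mem_closedBall_zero_iff] at this
      linarith) a hε
  exact ⟨hη.contDiff.comp (by fun_prop), IsCompact.of_isClosed_subset (isCompact_closedBall a ε)
    (isClosed_tsupport _) hs, hs⟩

/-- The mean growth of `U` at `a` at scale `ε`. -/
noncomputable def scaledMass (m : ℕ) (U : 𝔼 → ℝ) (a : 𝔼) (ε : ℝ) : ℝ :=
  (∫ y in Metric.closedBall a ε, |U y|) / ε ^ (2 * m)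

/-- Only the part of `φ` near `a` contributes, and `exists_bound_iterLaplacian_mul` makes that part
negligible as `ε → 0`. -/
lemma weakIterLaplacian_eq_zero_of_apply_eq_zero {U φ : 𝔼 → ℝ} {a : 𝔼} {R : ℝ} {m : ℕ}
    (hU : Integrable U) (hpoly : IsPolyharmonicOn m U (Metric.ball a R \ {a}))
    (hmass : Tendsto (fun ε => ε * scaledMass m U a ε) (𝓝[>] 0) (𝓝 0))
    (hφ : IsTestOn φ (Metric.ball a R)) (hφa : φ a = 0) : weakIterLaplacian m U φ = 0 := by
  obtain ⟨K, hK⟩ := exists_bound_iterLaplacian_mul hφ hφa (isTestOn_unitBump (n := n)) m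
  have hbound : ∀ ε : ℝ, 0 < ε → ε ≤ 1 →
      |weakIterLaplacian m U φ| ≤ K * (ε * scaledMass m U a ε) := by
    intro ε hε hε1
    have hη := (isTestOn_unitBump (n := n)).comp_homothety a hε
    set φ₁ : 𝔼 → ℝ := fun z => φ z * unitBump n (ε⁻¹ • (z - a)) with hφ₁
    have hsφ : tsupport φ₁ ⊆ tsupport φ := closure_mono (Function.support_mul_subset_left _ _)
    have hsε : tsupport φ₁ ⊆ Metric.closedBall a ε :=
      (closure_mono (Function.support_mul_subset_right _ _)).trans hη.tsupport_subset
    have h1 : IsTestOn φ₁ (Metric.ball a R) :=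
      ⟨hφ.contDiff.mul hη.contDiff, hφ.hasCompactSupport.mul_right, hsφ.trans hφ.tsupport_subset⟩
    have h2 : IsTestOn (fun x => φ x - φ₁ x) (Metric.ball a R \ {a}) := by
      have h := hφ.sub h1
      refine ⟨h.contDiff, h.hasCompactSupport, fun x hx => ⟨h.tsupport_subset hx, ?_⟩⟩
      rintro rfl
      refine absurd hx ?_
      rw [notMem_tsupport_iff_eventuallyEq]
      -- The rescaled bump is `1` on the ball of radius `ε / 2`, so `φ - φ₁` vanishes near the
      -- singular point.
      filter_upwards [Metric.closedBall_mem_nhds x (show 0 < ε / 2 by positivity)] with y hy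
      have hb : unitBump n (ε⁻¹ • (y - x)) = 1 := by
        refine (unitBump n).one_of_mem_closedBall ?_
        rw [mem_closedBall_zero_iff, norm_smul, norm_inv, Real.norm_of_nonneg hε.le,
          inv_mul_eq_div, div_le_iff₀ hε]
        rw [Metric.mem_closedBall, dist_eq_norm] at hy
        exact hy.trans_eq (by simp [unitBump]; ring)
      simp [hφ₁, hb]
    have h3 := weakIterLaplacian_eq_zero_of_classical
      (Metric.isOpen_ball.sdiff isClosed_singleton) hpoly h2
    rw [weakIterLaplacian_sub hU hφ h1, sub_eq_zero] at h3
    rw [h3]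
    refine (abs_integral_mul_le_of_closedBall hU (fun y hy =>
      iterLaplacian_eq_zero_of_notMem_tsupport (fun h => hy (hsε h)) m) (hK ε hε hε1)).trans_eq ?_
    rw [scaledMass]
    ring
  have hlim : Tendsto (fun ε => K * (ε * scaledMass m U a ε)) (𝓝[>] 0) (𝓝 0) := by
    simpa using hmass.const_mul K
  have hle : |weakIterLaplacian m U φ| ≤ 0 := by
    refine ge_of_tendsto hlim ?_
    filter_upwards [Ioc_mem_nhdsGT (zero_lt_one' ℝ)] with ε hε using hbound ε hε.1 hε.2
  exact abs_eq_zero.1 (le_antisymm hle (abs_nonneg _))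

/-- The distribution `Δ^m U` is a multiple of the Dirac mass; it vanishes if it is small on some
test functions that are large at `a`. -/
lemma weakIterLaplacian_eq_zero_of_forall_exists {U : 𝔼 → ℝ} {a : 𝔼} {R : ℝ} {m : ℕ}
    (hU : Integrable U) (hpoly : IsPolyharmonicOn m U (Metric.ball a R \ {a}))
    (hmass : Tendsto (fun ε => ε * scaledMass m U a ε) (𝓝[>] 0) (𝓝 0))
    (hsmall : ∀ κ > 0, ∃ ψ, IsTestOn ψ (Metric.ball a R) ∧ ψ a ≠ 0 ∧
      |weakIterLaplacian m U ψ| ≤ κ * |ψ a|)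
    {φ : 𝔼 → ℝ} (hφ : IsTestOn φ (Metric.ball a R)) : weakIterLaplacian m U φ = 0 := by
  have hle : ∀ κ > 0, |weakIterLaplacian m U φ| ≤ κ * |φ a| := by
    intro κ hκ
    obtain ⟨ψ, hψ, hψa, hb⟩ := hsmall κ hκ
    -- The combination `ψ(a) φ - φ(a) ψ` vanishes at `a`, so the two pairings are proportional to
    -- the values at `a`.
    have h := weakIterLaplacian_eq_zero_of_apply_eq_zero hU hpoly hmass
      ((hφ.const_mul (ψ a)).sub (hψ.const_mul (φ a))) (mul_comm (ψ a) (φ a) ▸ sub_self _)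
    rw [weakIterLaplacian_sub hU (hφ.const_mul (ψ a)) (hψ.const_mul (φ a)),
      weakIterLaplacian_const_mul U hφ.contDiff, weakIterLaplacian_const_mul U hψ.contDiff,
      sub_eq_zero] at h
    have h' := congrArg abs h
    rw [abs_mul, abs_mul] at h'
    have hpos : 0 < |ψ a| := abs_pos.2 hψa
    refine le_of_mul_le_mul_left ?_ hpos
    rw [h']
    nlinarith [mul_le_mul_of_nonneg_left hb (abs_nonneg (φ a))]
  have hlim : Tendsto (fun κ : ℝ => κ * |φ a|) (𝓝[>] 0) (𝓝 0) := by
    have h : Tendsto (fun κ : ℝ => κ * |φ a|) (𝓝 0) (𝓝 (0 * |φ a|)) :=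
      (continuous_id.mul continuous_const).tendsto 0
    rw [zero_mul] at h
    exact h.mono_left nhdsWithin_le_nhds
  have h0 : |weakIterLaplacian m U φ| ≤ 0 := by
    refine ge_of_tendsto hlim ?_
    filter_upwards [self_mem_nhdsWithin] with κ hκ using hle κ hκ
  exact abs_eq_zero.1 (le_antisymm h0 (abs_nonneg _))

/-- Testing with rescalings of a function `G` that is polyharmonic outside the unit ball. -/
lemma exists_bound_weakIterLaplacian_comp_homothety {G : 𝔼 → ℝ} (hG : ContDiff ℝ ∞ G) {m : ℕ}
    (h0 : ∀ y, 1 < ‖y‖ → iterLaplacian m G y = 0) {U : 𝔼 → ℝ} (hU : Integrable U) (a : 𝔼) :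
    ∃ C, ∀ ε : ℝ, 0 < ε →
      Integrable (fun y => U y * iterLaplacian m (fun y => G (ε⁻¹ • (y - a))) y) ∧
      |weakIterLaplacian m U (fun y => G (ε⁻¹ • (y - a)))| ≤ C * scaledMass m U a ε := by
  have hcont := (hG.iterLaplacian m).continuous
  have hcs : HasCompactSupport (iterLaplacian m G) := by
    refine HasCompactSupport.intro (isCompact_closedBall (0 : 𝔼) 1) fun y hy => h0 y ?_
    rwa [mem_closedBall_zero_iff, not_le] at hy
  obtain ⟨C, hC⟩ := hcs.exists_bound_of_continuous hcont
  refine ⟨C, fun ε hε => ?_⟩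
  have hb : ∀ y, |iterLaplacian m (fun y => G (ε⁻¹ • (y - a))) y| ≤ C * (ε ^ (2 * m))⁻¹ := by
    intro y
    rw [iterLaplacian_comp_homothety hG, abs_mul, inv_pow, abs_of_pos (by positivity), mul_comm]
    exact mul_le_mul_of_nonneg_right (hC _) (by positivity)
  have hGε : ContDiff ℝ ∞ (fun y => G (ε⁻¹ • (y - a))) := hG.comp (by fun_prop)
  refine ⟨hU.mul_bdd (hGε.iterLaplacian m).continuous.aestronglyMeasurable (ae_of_all _ hb), ?_⟩
  refine (abs_integral_mul_le_of_closedBall (a := a) (ε := ε) hU (fun y hy => ?_)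
    (fun y _ => hb y)).trans_eq ?_
  · rw [iterLaplacian_comp_homothety hG]
    refine mul_eq_zero_of_right _ (h0 _ ?_)
    rw [Metric.mem_closedBall, dist_eq_norm, not_le] at hy
    rw [norm_smul, norm_inv, Real.norm_of_nonneg hε.le, inv_mul_eq_div]
    exact (one_lt_div hε).2 hy
  · rw [scaledMass]
    ring

/-- Shrinking bumps keep the value `1` at `a`, while their pairing is at most a constant times
`scaledMass`. -/
lemma weakIterLaplacian_eq_zero_of_tendsto_scaledMass {U : 𝔼 → ℝ} {a : 𝔼} {R : ℝ} {m : ℕ}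
    (hR : 0 < R) (hU : Integrable U) (hpoly : IsPolyharmonicOn m U (Metric.ball a R \ {a}))
    (hmass : Tendsto (scaledMass m U a) (𝓝[>] 0) (𝓝 0))
    {φ : 𝔼 → ℝ} (hφ : IsTestOn φ (Metric.ball a R)) : weakIterLaplacian m U φ = 0 := by
  have hid : Tendsto (fun ε : ℝ => ε) (𝓝[>] 0) (𝓝 0) := tendsto_id.mono_left nhdsWithin_le_nhds
  refine weakIterLaplacian_eq_zero_of_forall_exists hU hpoly (by simpa using hid.mul hmass)
    (fun κ hκ => ?_) hφ
  have hη := isTestOn_unitBump (n := n)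
  obtain ⟨C, hC⟩ := exists_bound_weakIterLaplacian_comp_homothety hη.contDiff (m := m)
    (fun y hy => iterLaplacian_eq_zero_of_notMem_tsupport (fun h => by
      have := hη.tsupport_subset h
      rw [mem_closedBall_zero_iff] at this
      linarith) m) hU a
  have hlim : Tendsto (fun ε => C * scaledMass m U a ε) (𝓝[>] 0) (𝓝 0) := by
    simpa using hmass.const_mul C
  obtain ⟨ε, hε1, hε⟩ := ((hlim.eventually_le_const hκ).and (Ioo_mem_nhdsGT hR)).exists
  have h1 : unitBump n (0 : 𝔼) = 1 :=
    (unitBump n).one_of_mem_closedBall (by simp [(unitBump n).rIn_pos.le])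
  have ht := hη.comp_homothety a hε.1
  refine ⟨fun y => unitBump n (ε⁻¹ • (y - a)), ⟨ht.contDiff, ht.hasCompactSupport,
    ht.tsupport_subset.trans (Metric.closedBall_subset_ball hε.2)⟩, by simp [h1], ?_⟩
  simpa [h1] using ((hC ε hε.1).2).trans hε1

end WeakSolutions

/-! ### The logarithmic test function and growth bounds on the scaled mass -/

section GrowthEstimates

set_option maxSynthPendingDepth 3

open MeasureTheory

variable {n : ℕ}

local notation "𝔼" => EuclideanSpace ℝ (Fin n)

/-- A smooth function on `ℝ` agreeing with the logarithm on `[1, ∞)`. -/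
noncomputable def logProfile (s : ℝ) : ℝ := Real.smoothTransition (2 * s - 1) * Real.log s

lemma logProfile_eq_log {s : ℝ} (hs : 1 ≤ s) : logProfile s = Real.log s := by
  rw [logProfile, Real.smoothTransition.one_of_one_le (by linarith), one_mul]

lemma contDiff_logProfile : ContDiff ℝ ∞ logProfile := by
  rw [contDiff_iff_contDiffAt]
  intro s
  by_cases hs : s = 0
  · have h : logProfile =ᶠ[𝓝 s] fun _ => 0 := by
      filter_upwards [gt_mem_nhds (show s < 1 / 2 by rw [hs]; norm_num)] with t ht
      rw [logProfile, Real.smoothTransition.zero_of_nonpos (by linarith), zero_mul]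
    exact contDiffAt_const.congr_of_eventuallyEq h
  · exact (Real.smoothTransition.contDiff.comp
      ((contDiff_const.mul contDiff_id).sub contDiff_const)).contDiffAt.mul (Real.contDiffAt_log.2 hs)

lemma iterLaplacian_const {m : ℕ} (hm : 1 ≤ m) (c : ℝ) :
    iterLaplacian m (fun _ : 𝔼 => c) = fun _ => 0 := by
  obtain ⟨k, rfl⟩ := Nat.exists_eq_add_of_le' hm
  rw [iterLaplacian_succ', InnerProductSpace.laplacian_const]
  exact iterLaplacian_const_zero k

lemma iterLaplacian_logProfile_eq_zero {m : ℕ} (hm : 1 ≤ m) {y : EuclideanSpace ℝ (Fin 2)}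
    (hy : 1 < ‖y‖) : iterLaplacian m (fun y => logProfile (‖y‖ ^ 2)) y = 0 := by
  have hopen : IsOpen {y : EuclideanSpace ℝ (Fin 2) | 1 < ‖y‖} :=
    isOpen_lt continuous_const continuous_norm
  have h1 : ∀ z : EuclideanSpace ℝ (Fin 2), 1 < ‖z‖ →
      Laplacian.laplacian (fun y : EuclideanSpace ℝ (Fin 2) => logProfile (‖y‖ ^ 2)) z = 0 := by
    intro z hz
    have hev : (fun y : EuclideanSpace ℝ (Fin 2) => logProfile (‖y‖ ^ 2)) =ᶠ[𝓝 z]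
        fun y => Real.log (‖y - 0‖ ^ 2) := by
      filter_upwards [hopen.mem_nhds hz] with w hw
      rw [logProfile_eq_log (one_le_pow₀ (le_of_lt hw)), sub_zero]
    rw [(InnerProductSpace.laplacian_congr_nhds hev).eq_of_nhds, laplacian_log_norm_sq]
    rintro rfl
    norm_num at hz
  obtain ⟨k, rfl⟩ := Nat.exists_eq_add_of_le' hm
  rw [iterLaplacian_succ']
  have hev : Laplacian.laplacian (fun y : EuclideanSpace ℝ (Fin 2) => logProfile (‖y‖ ^ 2))
      =ᶠ[𝓝 y] fun _ => 0 := by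
    filter_upwards [hopen.mem_nhds hy] with w hw using h1 w hw
  rw [(iterLaplacian_congr_nhds hev k).eq_of_nhds, iterLaplacian_const_zero]

lemma tendsto_log_inv_atTop : Tendsto (fun ε : ℝ => Real.log (1 / ε)) (𝓝[>] 0) atTop := by
  simp only [one_div]
  exact Real.tendsto_log_atTop.comp tendsto_inv_nhdsGT_zero

/-- Bumps no longer suffice, as `scaledMass` may grow. A difference of two rescaled `logProfile`s,
shifted by a constant, gains a factor `log (1/ε)` at `a`. -/
lemma weakIterLaplacian_eq_zero_of_tendsto_scaledMass_div_log {U : EuclideanSpace ℝ (Fin 2) → ℝ}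
    {a : EuclideanSpace ℝ (Fin 2)} {R : ℝ} {m : ℕ} (hm : 1 ≤ m) (hR : 0 < R) (hU : Integrable U)
    (hpoly : IsPolyharmonicOn m U (Metric.ball a R \ {a}))
    (hmass : Tendsto (fun ε => scaledMass m U a ε / Real.log (1 / ε)) (𝓝[>] 0) (𝓝 0))
    {φ : EuclideanSpace ℝ (Fin 2) → ℝ} (hφ : IsTestOn φ (Metric.ball a R)) :
    weakIterLaplacian m U φ = 0 := by
  have hmass' : Tendsto (fun ε => ε * scaledMass m U a ε) (𝓝[>] 0) (𝓝 0) := by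
    have h1 : Tendsto (fun ε : ℝ => -(Real.log ε * ε)) (𝓝[>] 0) (𝓝 0) := by
      simpa using (tendsto_log_mul_rpow_nhdsGT_zero zero_lt_one).neg
    have h2 := h1.mul hmass
    rw [zero_mul] at h2
    refine h2.congr' ?_
    filter_upwards [tendsto_log_inv_atTop.eventually_gt_atTop 0] with ε hε
    have h3 : -(Real.log ε * ε) = ε * Real.log (1 / ε) := by
      rw [one_div, Real.log_inv]
      ring
    rw [h3]
    field_simp
  refine weakIterLaplacian_eq_zero_of_forall_exists hU hpoly hmass' (fun κ hκ => ?_) hφ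
  set G : EuclideanSpace ℝ (Fin 2) → ℝ := fun y => logProfile (‖y‖ ^ 2) with hGdef
  have hG : ContDiff ℝ ∞ G := contDiff_logProfile.comp (contDiff_id.norm_sq ℝ)
  obtain ⟨C, hC⟩ := exists_bound_weakIterLaplacian_comp_homothety hG (m := m)
    (fun y hy => iterLaplacian_logProfile_eq_zero hm hy) hU a
  set δ : ℝ := R / 2
  have hδ : 0 < δ := by positivity
  have hlim : Tendsto (fun ε => C * (scaledMass m U a ε / Real.log (1 / ε))) (𝓝[>] 0) (𝓝 0) := by
    simpa using hmass.const_mul C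
  -- In order: the scale-`ε` pairing takes at most half of `κ log (1/ε)`; so does the pairing at the
  -- fixed scale `δ`; and `lam ≥ log (1/ε)` below.
  obtain ⟨ε, ⟨⟨⟨hε1, hε2⟩, hε3⟩, hε4⟩, hε⟩ :=
    ((((hlim.eventually_le_const (show 0 < κ / 2 by positivity)).and
      (tendsto_log_inv_atTop.eventually_ge_atTop (C * scaledMass m U a δ / (κ / 2)))).and
      (tendsto_log_inv_atTop.eventually_ge_atTop (-(2 * Real.log δ)))).and
      (tendsto_log_inv_atTop.eventually_gt_atTop 0)).and (Ioo_mem_nhdsGT hδ) |>.exists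
  have hε0 : 0 < ε := hε.1
  set lam : ℝ := 2 * Real.log δ + 2 * Real.log (1 / ε) with hlam
  have hlam1 : Real.log (1 / ε) ≤ lam := by linarith
  have hlam0 : 0 < lam := by linarith
  have hGε : ContDiff ℝ ∞ (fun y => G (ε⁻¹ • (y - a))) := hG.comp (by fun_prop)
  have hGδ : ContDiff ℝ ∞ (fun y => G (δ⁻¹ • (y - a))) := hG.comp (by fun_prop)
  have hsq : ∀ (r : ℝ), 0 < r → ∀ y, r ≤ ‖y - a‖ →
      G (r⁻¹ • (y - a)) = 2 * Real.log ‖y - a‖ - 2 * Real.log r := by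
    intro r hr y hy
    have h0 : 0 < ‖y - a‖ := hr.trans_le hy
    have h1 : ‖r⁻¹ • (y - a)‖ = ‖y - a‖ / r := by
      rw [norm_smul, norm_inv, Real.norm_of_nonneg hr.le, inv_mul_eq_div]
    simp only [hGdef, h1]
    rw [logProfile_eq_log (one_le_pow₀ ((one_le_div hr).2 hy)), Real.log_pow,
      Real.log_div h0.ne' hr.ne']
    push_cast
    ring
  -- Beyond radius `δ` both terms are exact logarithms, and their difference is the constant `2 log
  -- (δ/ε) = lam`. Subtracting it gives compact support and the value `-lam` at `a`.
  set ψ : EuclideanSpace ℝ (Fin 2) → ℝ :=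
    fun y => (G (ε⁻¹ • (y - a)) - G (δ⁻¹ • (y - a))) - lam with hψ
  have hψs : tsupport ψ ⊆ Metric.closedBall a δ := by
    refine closure_minimal (fun y hy => ?_) Metric.isClosed_closedBall
    by_contra h
    rw [Metric.mem_closedBall, dist_eq_norm, not_le] at h
    refine hy ?_
    simp only [hψ]
    rw [hsq ε hε0 y (hε.2.le.trans h.le), hsq δ hδ y h.le, hlam, one_div, Real.log_inv]
    ring
  have hψa : ψ a = -lam := by simp [hψ, hGdef]
  refine ⟨ψ, ⟨(hGε.sub hGδ).sub contDiff_const, IsCompact.of_isClosed_subset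
    (isCompact_closedBall a δ) (isClosed_tsupport _) hψs,
    hψs.trans (Metric.closedBall_subset_ball (by simp only [δ]; linarith))⟩,
    by rw [hψa]; exact (neg_neg_of_pos hlam0).ne, ?_⟩
  have hT : weakIterLaplacian m U ψ = weakIterLaplacian m U (fun y => G (ε⁻¹ • (y - a))) -
      weakIterLaplacian m U (fun y => G (δ⁻¹ • (y - a))) := by
    unfold weakIterLaplacian
    rw [← integral_sub (hC ε hε0).1 (hC δ hδ).1, hψ,
      iterLaplacian_sub (hGε.sub hGδ) contDiff_const, iterLaplacian_sub hGε hGδ,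
      iterLaplacian_const hm]
    simp only [sub_zero, mul_sub]
  rw [hT, hψa, abs_neg, abs_of_pos hlam0]
  have hb1 := (hC ε hε0).2
  have hb2 := (hC δ hδ).2
  have hb3 : C * scaledMass m U a ε ≤ κ / 2 * Real.log (1 / ε) := by
    rwa [← mul_div_assoc, div_le_iff₀ hε4] at hε1
  have hb4 : C * scaledMass m U a δ ≤ κ / 2 * Real.log (1 / ε) := by
    rw [div_le_iff₀ (by positivity)] at hε2
    linarith
  have hb5 : κ * Real.log (1 / ε) ≤ κ * lam := mul_le_mul_of_nonneg_left hlam1 hκ.le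
  refine (abs_sub _ _).trans ?_
  linarith

lemma integrableOn_norm_zpow_ball {m : ℕ} (hn : 1 ≤ n) (hm : 1 ≤ m) (r : ℝ) :
    IntegrableOn (fun y : 𝔼 => ‖y‖ ^ (2 * (m : ℤ) - n)) (Metric.ball 0 r) := by
  have : Nonempty (Fin n) := ⟨⟨0, hn⟩⟩
  rw [integrableOn_fun_norm_addHaar (μ := (volume : Measure 𝔼))
    (f := fun s => s ^ (2 * (m : ℤ) - n)), finrank_euclideanSpace_fin]
  -- In polar coordinates the weight `s^(n-1)` turns `s^(2m-n)` into `s^(2m-1)`.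
  have hc : IntegrableOn (fun y : ℝ => y ^ (2 * m - 1)) (Ioo 0 r) :=
    ((continuous_pow _).integrableOn_Icc (a := 0) (b := r)).mono_set Ioo_subset_Icc_self
  refine hc.congr_fun (fun y hy => ?_) measurableSet_Ioo
  simp only [smul_eq_mul]
  rw [← zpow_natCast, ← zpow_natCast, ← zpow_add₀ hy.1.ne']
  congr 1
  push_cast [Nat.cast_sub hn, Nat.cast_sub (show 1 ≤ 2 * m by omega)]
  ring

lemma integrableOn_norm_sub_zpow_ball {m : ℕ} (hn : 1 ≤ n) (hm : 1 ≤ m) (a : 𝔼) (r : ℝ) :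
    IntegrableOn (fun y : 𝔼 => ‖y - a‖ ^ (2 * (m : ℤ) - n)) (Metric.ball a r) := by
  have h := (integrable_indicator_iff Metric.isOpen_ball.measurableSet).2
    (integrableOn_norm_zpow_ball (n := n) hn hm r)
  have h' := h.comp_sub_right a
  rw [← integrable_indicator_iff Metric.isOpen_ball.measurableSet]
  refine h'.congr (ae_of_all _ fun y => ?_)
  simp only [indicator, Metric.mem_ball, dist_eq_norm, sub_zero]

lemma setIntegral_norm_sub_zpow_closedBall {m : ℕ} (a : 𝔼) {ε : ℝ} (hε : 0 < ε) :
    ∫ y in Metric.closedBall a ε, ‖y - a‖ ^ (2 * (m : ℤ) - n) =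
      ε ^ (2 * m) * ∫ y in Metric.closedBall (0 : 𝔼) 1, ‖y‖ ^ (2 * (m : ℤ) - n) := by
  have h1 : ∫ y in Metric.closedBall a ε, ‖y - a‖ ^ (2 * (m : ℤ) - n) =
      ∫ y in Metric.closedBall (0 : 𝔼) ε, ‖y‖ ^ (2 * (m : ℤ) - n) := by
    rw [← integral_indicator Metric.isClosed_closedBall.measurableSet,
      ← integral_indicator Metric.isClosed_closedBall.measurableSet,
      ← integral_sub_right_eq_self
        ((Metric.closedBall (0 : 𝔼) ε).indicator fun y => ‖y‖ ^ (2 * (m : ℤ) - n)) a]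
    congr 1
    ext y
    simp only [indicator, Metric.mem_closedBall, dist_eq_norm, sub_zero]
  have h2 := Measure.setIntegral_comp_smul (volume : Measure 𝔼)
    (fun y => ‖y‖ ^ (2 * (m : ℤ) - n)) (Metric.closedBall 0 1) hε.ne'
  rw [smul_closedBall _ _ zero_le_one, smul_zero, mul_one, Real.norm_of_nonneg hε.le,
    finrank_euclideanSpace_fin, abs_of_pos (by positivity), smul_eq_mul] at h2
  simp only [norm_smul, Real.norm_of_nonneg hε.le, mul_zpow] at h2
  rw [integral_const_mul] at h2
  have hεn : ε ^ n ≠ 0 := by positivity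
  rw [eq_comm, inv_mul_eq_iff_eq_mul₀ hεn, ← mul_assoc] at h2
  rw [h1, h2]
  congr 1
  rw [← zpow_natCast, ← zpow_natCast, ← zpow_add₀ hε.ne']
  congr 1
  push_cast
  ring

/-- The integral of `‖y - a‖^(2m-n)` over the `ε`-ball is exactly a constant times `ε^(2m)`, the
normalization in `scaledMass`. -/
lemma tendsto_scaledMass_of_isLittleO {m : ℕ} (hn : 1 ≤ n) (hm : 1 ≤ m) {U : 𝔼 → ℝ} {a : 𝔼}
    (hU : Integrable U) (h : U =o[𝓝[≠] a] fun x => ‖x - a‖ ^ (2 * (m : ℤ) - n)) :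
    Tendsto (scaledMass m U a) (𝓝[>] 0) (𝓝 0) := by
  have : Nonempty (Fin n) := ⟨⟨0, hn⟩⟩
  set I : ℝ := ∫ y in Metric.closedBall (0 : 𝔼) 1, ‖y‖ ^ (2 * (m : ℤ) - n)
  have hI : 0 ≤ I := integral_nonneg fun y => by positivity
  have hmass0 : ∀ ε : ℝ, 0 < ε → 0 ≤ scaledMass m U a ε := fun ε hε =>
    div_nonneg (integral_nonneg fun y => abs_nonneg _) (by positivity)
  rw [Metric.tendsto_nhds]
  intro κ hκ
  -- Dividing by `I + 1` avoids treating `I = 0` separately and makes the final bound strictly less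
  -- than `κ`.
  have hκ' : 0 < κ / (I + 1) / 2 := by positivity
  obtain ⟨r, hr, hb⟩ := Metric.mem_nhdsWithin_iff.1 (h.bound hκ')
  filter_upwards [Ioo_mem_nhdsGT hr] with ε hε
  have hle : ∫ y in Metric.closedBall a ε, |U y| ≤
      ∫ y in Metric.closedBall a ε, κ / (I + 1) / 2 * ‖y - a‖ ^ (2 * (m : ℤ) - n) := by
    refine setIntegral_mono_on_ae hU.abs.integrableOn ?_ Metric.isClosed_closedBall.measurableSet ?_
    · exact ((integrableOn_norm_sub_zpow_ball hn hm a r).mono_set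
        (Metric.closedBall_subset_ball hε.2)).const_mul _
    · filter_upwards [compl_mem_ae_iff.2 (measure_singleton (μ := (volume : Measure 𝔼)) a)]
        with y hy hyε
      have := hb ⟨Metric.closedBall_subset_ball hε.2 hyε, hy⟩
      simpa using this
  rw [integral_const_mul, setIntegral_norm_sub_zpow_closedBall a hε.1] at hle
  rw [Real.dist_eq, sub_zero, abs_of_nonneg (hmass0 ε hε.1), scaledMass,
    div_lt_iff₀ (pow_pos hε.1 _)]
  have hp : 0 < ε ^ (2 * m) := pow_pos hε.1 _
  have h3 : κ / (I + 1) / 2 * I < κ := by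
    rw [div_div, div_mul_eq_mul_div, div_lt_iff₀ (by positivity)]
    nlinarith
  calc _ ≤ _ := hle
    _ = (κ / (I + 1) / 2 * I) * ε ^ (2 * m) := by ring
    _ < κ * ε ^ (2 * m) := mul_lt_mul_of_pos_right h3 hp

/-- `log t / t` decreases on `[e, ∞)`; put `t = 1/r`. This bounds the planar growth function on a
ball by its value at the radius. -/
lemma pow_mul_log_inv_mono {k : ℕ} (hk : 1 ≤ k) {r ε : ℝ} (hr : 0 < r) (hrε : r ≤ ε)
    (hε : ε ≤ Real.exp (-1)) : r ^ k * Real.log (1 / r) ≤ ε ^ k * Real.log (1 / ε) := by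
  obtain ⟨k, rfl⟩ := Nat.exists_eq_add_of_le' hk
  have hε0 : 0 < ε := hr.trans_le hrε
  have hinv : ∀ s, 0 < s → s ≤ Real.exp (-1) → Real.exp 1 ≤ 1 / s := by
    intro s hs h
    rw [le_div_iff₀ hs]
    calc Real.exp 1 * s ≤ Real.exp 1 * Real.exp (-1) := by gcongr
      _ = 1 := by rw [← Real.exp_add]; simp
  have h1 := Real.log_div_self_antitoneOn (hinv ε hε0 hε) (hinv r hr (hrε.trans hε))
    (one_div_le_one_div_of_le hr hrε)
  simp only [div_div_eq_mul_div, div_one] at h1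
  have h0 : 0 ≤ Real.log (1 / r) := Real.log_nonneg
    ((Real.one_le_exp zero_le_one).trans (hinv r hr (hrε.trans hε)))
  calc r ^ (k + 1) * Real.log (1 / r) = r ^ k * (Real.log (1 / r) * r) := by ring
    _ ≤ ε ^ k * (Real.log (1 / ε) * ε) := by
        refine mul_le_mul (pow_le_pow_left₀ hr.le hrε k) h1 (by positivity) (by positivity)
    _ = ε ^ (k + 1) * Real.log (1 / ε) := by ring

lemma tendsto_scaledMass_div_log_of_isLittleO {m : ℕ} (hm : 2 ≤ m)
    {U : EuclideanSpace ℝ (Fin 2) → ℝ} {a : EuclideanSpace ℝ (Fin 2)} (hU : Integrable U)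
    (h : U =o[𝓝[≠] a] fun x => ‖x - a‖ ^ (2 * (m : ℤ) - 2) * Real.log (1 / ‖x - a‖)) :
    Tendsto (fun ε => scaledMass m U a ε / Real.log (1 / ε)) (𝓝[>] 0) (𝓝 0) := by
  set V : ℝ := volume.real (Metric.ball (0 : EuclideanSpace ℝ (Fin 2)) 1)
  have hV : 0 ≤ V := measureReal_nonneg
  have hmass0 : ∀ ε : ℝ, 0 < ε → 0 ≤ scaledMass m U a ε := fun ε hε =>
    div_nonneg (integral_nonneg fun y => abs_nonneg _) (by positivity)
  rw [Metric.tendsto_nhds]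
  intro κ hκ
  have hκ' : 0 < κ / (V + 1) / 2 := by positivity
  obtain ⟨r, hr, hb⟩ := Metric.mem_nhdsWithin_iff.1 (h.bound hκ')
  filter_upwards [Ioo_mem_nhdsGT hr, Ioo_mem_nhdsGT (Real.exp_pos (-1)),
    tendsto_log_inv_atTop.eventually_gt_atTop 0] with ε hε hε1 hlog
  have hε0 : 0 < ε := hε.1
  have hvol : volume.real (Metric.closedBall a ε) = ε ^ 2 * V := by
    rw [Measure.addHaar_real_closedBall _ _ hε0.le, finrank_euclideanSpace_fin]
  have hle : ∫ y in Metric.closedBall a ε, |U y| ≤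
      ∫ y in Metric.closedBall a ε, κ / (V + 1) / 2 * (ε ^ (2 * m - 2) * Real.log (1 / ε)) := by
    refine setIntegral_mono_on_ae hU.abs.integrableOn ?_ Metric.isClosed_closedBall.measurableSet ?_
    · exact integrableOn_const (isCompact_closedBall a ε).measure_lt_top.ne
    · filter_upwards [compl_mem_ae_iff.2 (measure_singleton
        (μ := (volume : Measure (EuclideanSpace ℝ (Fin 2)))) a)] with y hy hyε
      have h1 := hb ⟨Metric.closedBall_subset_ball hε.2 hyε, hy⟩
      have hpos : 0 < ‖y - a‖ := norm_pos_iff.2 (sub_ne_zero.2 hy)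
      rw [Metric.mem_closedBall, dist_eq_norm] at hyε
      have h2 := pow_mul_log_inv_mono (k := 2 * m - 2) (by omega) hpos hyε hε1.2.le
      have h3 : ‖y - a‖ ^ (2 * (m : ℤ) - 2) = ‖y - a‖ ^ (2 * m - 2) := by
        rw [← zpow_natCast]
        congr 1
        push_cast [Nat.cast_sub (show 2 ≤ 2 * m by omega)]
        ring
      have h4 : 0 ≤ Real.log (1 / ‖y - a‖) :=
        hlog.le.trans (Real.log_le_log (by positivity) (one_div_le_one_div_of_le hpos hyε))
      simp only [mem_ofPred_eq] at h1
      rw [h3, norm_mul, Real.norm_of_nonneg h4, Real.norm_of_nonneg (pow_nonneg (norm_nonneg _) _),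
        Real.norm_eq_abs] at h1
      exact h1.trans (mul_le_mul_of_nonneg_left h2 hκ'.le)
  rw [setIntegral_const, hvol, smul_eq_mul] at hle
  rw [Real.dist_eq, sub_zero, abs_of_nonneg (div_nonneg (hmass0 ε hε0) hlog.le),
    div_lt_iff₀ hlog, scaledMass, div_lt_iff₀ (by positivity)]
  have hp : 0 < ε ^ (2 * m) := by positivity
  have h3 : V * (κ / (V + 1) / 2) < κ := by
    rw [div_div, mul_div_assoc', div_lt_iff₀ (by positivity)]
    nlinarith
  have h5 : ε ^ (2 * m) = ε ^ 2 * ε ^ (2 * m - 2) := by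
    rw [← pow_add]
    congr 1
    omega
  calc _ ≤ _ := hle
    _ = (V * (κ / (V + 1) / 2)) * (Real.log (1 / ε) * ε ^ (2 * m)) := by rw [h5]; ring
    _ < κ * (Real.log (1 / ε) * ε ^ (2 * m)) := mul_lt_mul_of_pos_right h3 (by positivity)
    _ = _ := by ring

end GrowthEstimates

/-! ### Mean value formula and smoothness of weak solutions -/

section Regularity

set_option maxSynthPendingDepth 3

open MeasureTheory

variable {n : ℕ}

local notation "𝔼" => EuclideanSpace ℝ (Fin n)

/-- The mean of `U` around `x` at scale `ε` with radial weight `k`. -/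
noncomputable def radialMean (k : ℝ → ℝ) (U : 𝔼 → ℝ) (x : 𝔼) (ε : ℝ) : ℝ :=
  ∫ y, U y * ((ε ^ n)⁻¹ * k (‖ε⁻¹ • (y - x)‖ ^ 2))

lemma integral_comp_homothety (g : 𝔼 → ℝ) (x : 𝔼) {ε : ℝ} (hε : 0 < ε) :
    ∫ y, (ε ^ n)⁻¹ * g (ε⁻¹ • (y - x)) = ∫ y, g y := by
  rw [integral_const_mul, integral_sub_right_eq_self (fun y => g (ε⁻¹ • y)) x,
    Measure.integral_comp_inv_smul, finrank_euclideanSpace_fin, abs_of_pos (by positivity),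
    smul_eq_mul, inv_mul_cancel_left₀ (by positivity)]

/-- The kernels `ε^(-n) k(‖z/ε‖²)` have constant integral, so their `ε`-derivative is a divergence:
this is where `radialEuler` enters. -/
lemma hasDerivAt_radial_dilation {k : ℝ → ℝ} (hk : ContDiff ℝ ∞ k) (z : 𝔼) {ε : ℝ} (hε : 0 < ε) :
    HasDerivAt (fun ε : ℝ => (ε ^ n)⁻¹ * k (‖ε⁻¹ • z‖ ^ 2))
      (-(ε ^ (n + 1))⁻¹ * radialEuler n k (‖ε⁻¹ • z‖ ^ 2)) ε := by
  have hs : ∀ r : ℝ, ‖r⁻¹ • z‖ ^ 2 = (r⁻¹) ^ 2 * ‖z‖ ^ 2 := fun r => by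
    rw [norm_smul, mul_pow, Real.norm_eq_abs, sq_abs]
  simp only [hs]
  have h1 : HasDerivAt (fun r : ℝ => (r ^ n)⁻¹) (-(n * ε ^ (n - 1)) / (ε ^ n) ^ 2) ε :=
    (hasDerivAt_pow n ε).inv (by positivity)
  have h2 : HasDerivAt (fun r : ℝ => (r⁻¹) ^ 2 * ‖z‖ ^ 2)
      (2 * ε⁻¹ * (-(ε ^ 2)⁻¹) * ‖z‖ ^ 2) ε := by
    simpa using ((hasDerivAt_inv hε.ne').pow 2).mul_const (‖z‖ ^ 2)
  have h3 := h1.mul ((hk.differentiable_infty _).hasDerivAt.comp ε h2)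
  refine h3.congr_deriv ?_
  simp only [radialEuler, Function.comp]
  -- The exponent `n - 1` is truncated at `n = 0`.
  rcases Nat.eq_zero_or_pos n with rfl | hn
  · simp
    field_simp
  · obtain ⟨p, rfl⟩ := Nat.exists_eq_add_of_le' hn
    simp only [Nat.add_sub_cancel]
    field_simp
    ring

lemma IsRadialProfile.exists_bound {k : ℝ → ℝ} (hk : IsRadialProfile k) :
    ∃ C, ∀ s, 0 ≤ s → |k s| ≤ C := by
  obtain ⟨C, hC⟩ := (isCompact_Icc (a := (0 : ℝ)) (b := 1)).exists_bound_of_continuousOn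
    hk.contDiff.continuous.continuousOn
  refine ⟨C, fun s hs => ?_⟩
  rcases le_total s 1 with h | h
  · exact hC s ⟨hs, h⟩
  · rw [hk.eq_zero s h, abs_zero]
    exact (norm_nonneg _).trans (hC 0 ⟨le_rfl, zero_le_one⟩)

lemma hasDerivAt_radialMean {k : ℝ → ℝ} (hk : IsRadialProfile k) {U : 𝔼 → ℝ} (hU : Integrable U)
    (x : 𝔼) {ε : ℝ} (hε : 0 < ε) :
    HasDerivAt (radialMean k U x)
      (∫ y, U y * (-(ε ^ (n + 1))⁻¹ * radialEuler n k (‖ε⁻¹ • (y - x)‖ ^ 2))) ε := by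
  obtain ⟨C, hC⟩ := hk.exists_bound
  obtain ⟨C', hC'⟩ := (hk.radialEuler n).exists_bound
  have hk0 := hk.contDiff.continuous
  have hk1 := (hk.radialEuler n).contDiff.continuous
  have hcont : ∀ r : ℝ, Continuous fun y : 𝔼 => (r ^ n)⁻¹ * k (‖r⁻¹ • (y - x)‖ ^ 2) := fun r =>
    continuous_const.mul (hk0.comp (by fun_prop))
  have hcont' : ∀ r : ℝ, Continuous fun y : 𝔼 =>
      -(r ^ (n + 1))⁻¹ * radialEuler n k (‖r⁻¹ • (y - x)‖ ^ 2) := fun r =>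
    continuous_const.mul (hk1.comp (by fun_prop))
  -- Restricting to radii above `ε / 2` keeps the negative powers of `r` bounded uniformly.
  refine (hasDerivAt_integral_of_dominated_loc_of_deriv_le (s := Ioi (ε / 2))
    (F := fun r y => U y * ((r ^ n)⁻¹ * k (‖r⁻¹ • (y - x)‖ ^ 2)))
    (F' := fun r y => U y * (-(r ^ (n + 1))⁻¹ * radialEuler n k (‖r⁻¹ • (y - x)‖ ^ 2)))
    (bound := fun y => |U y| * (((ε / 2) ^ (n + 1))⁻¹ * C'))
    (Ioi_mem_nhds (by linarith))
    (Eventually.of_forall fun r => hU.aestronglyMeasurable.mul (hcont r).aestronglyMeasurable)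
    (hU.mul_bdd (hcont ε).aestronglyMeasurable (c := (ε ^ n)⁻¹ * C) (ae_of_all _ fun y => ?_))
    (hU.aestronglyMeasurable.mul (hcont' ε).aestronglyMeasurable)
    (ae_of_all _ fun y r hr => ?_) (hU.abs.mul_const _) (ae_of_all _ fun y r hr => ?_)).2
  · rw [norm_mul, Real.norm_of_nonneg (by positivity)]
    exact mul_le_mul_of_nonneg_left (hC _ (by positivity)) (by positivity)
  · have hr' : ε / 2 < r := hr
    have hr0 : 0 < r := by linarith
    rw [norm_mul, norm_mul, norm_neg, Real.norm_of_nonneg (show 0 ≤ (r ^ (n + 1))⁻¹ by positivity)]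
    refine mul_le_mul_of_nonneg_left ?_ (abs_nonneg _)
    exact mul_le_mul (by gcongr) (hC' _ (by positivity)) (norm_nonneg _) (by positivity)
  · have hr' : ε / 2 < r := hr
    exact (hasDerivAt_radial_dilation hk.contDiff (y - x) (by linarith)).const_mul (U y)

/-- An approximate identity, up to the factor `∫ k`; the kernel may change sign, so the error is
measured with `∫ |k|`. -/
lemma tendsto_radialMean {k : ℝ → ℝ} (hk : IsRadialProfile k) {U : 𝔼 → ℝ} (hU : Integrable U)
    {x : 𝔼} (hx : ContinuousAt U x) :
    Tendsto (radialMean k U x) (𝓝[>] 0) (𝓝 (U x * ∫ y : 𝔼, k (‖y‖ ^ 2))) := by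
  set I : ℝ := ∫ y : 𝔼, |k (‖y‖ ^ 2)|
  have hI : 0 ≤ I := integral_nonneg fun y => abs_nonneg _
  rw [Metric.tendsto_nhds]
  intro κ hκ
  have hκ' : 0 < κ / (I + 1) / 2 := by positivity
  obtain ⟨r, hr, hb⟩ := Metric.continuousAt_iff.1 hx _ hκ'
  filter_upwards [Ioo_mem_nhdsGT hr] with ε hε
  have hε0 : 0 < ε := hε.1
  set K : 𝔼 → ℝ := fun y => (ε ^ n)⁻¹ * k (‖ε⁻¹ • (y - x)‖ ^ 2) with hK
  have hKc : Continuous K := continuous_const.mul (hk.contDiff.continuous.comp (by fun_prop))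
  have hKs : HasCompactSupport K := (hk.hasCompactSupport x hε0).mul_left
  have hKi : Integrable K := hKc.integrable_of_hasCompactSupport hKs
  have h1 : radialMean k U x ε - U x * ∫ y : 𝔼, k (‖y‖ ^ 2) = ∫ y, (U y - U x) * K y := by
    rw [← integral_comp_homothety (fun y : 𝔼 => k (‖y‖ ^ 2)) x hε0, ← integral_const_mul,
      radialMean, ← integral_sub (Integrable.mul_of_hasCompactSupport hU hKc hKs)
        (hKi.const_mul _)]
    simp only [sub_mul, hK]
  have h2 : ∫ y, κ / (I + 1) / 2 * |K y| = κ / (I + 1) / 2 * I := by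
    have h := integral_comp_homothety (fun y : 𝔼 => |k (‖y‖ ^ 2)|) x hε0
    rw [integral_const_mul, show I = _ from h.symm]
    congr 2
    ext y
    rw [hK, abs_mul, abs_of_pos (show 0 < (ε ^ n)⁻¹ by positivity)]
  rw [Real.dist_eq, h1, ← Real.norm_eq_abs]
  refine (norm_integral_le_of_norm_le (hKi.abs.const_mul (κ / (I + 1) / 2))
    (ae_of_all _ fun y => ?_)).trans_lt ?_
  · rw [norm_mul, Real.norm_eq_abs (K y)]
    rcases lt_or_ge (dist y x) r with h | h
    · exact mul_le_mul_of_nonneg_right (hb h).le (abs_nonneg _)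
    · have hK0 : K y = 0 := by
        rw [hK]
        refine mul_eq_zero_of_right _ (hk.eq_zero _ (one_le_pow₀ ?_))
        rw [norm_smul, norm_inv, Real.norm_of_nonneg hε0.le, inv_mul_eq_div, one_le_div hε0,
          ← dist_eq_norm]
        exact hε.2.le.trans h
      simp [hK0]
  · rw [h2, div_div, div_mul_eq_mul_div, div_lt_iff₀ (by positivity)]
    nlinarith

/-- Mean value property for weak solutions of `Δ^m U = 0`. -/
lemma radialMean_eq_of_weak {f k : ℝ → ℝ} {m : ℕ} (hf : IsRadialProfile f) (hk : IsRadialProfile k)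
    (hkf : radialEuler n k = (radialLap n)^[m] f) {U : 𝔼 → ℝ} (hU : Integrable U) {x : 𝔼}
    (hx : ContinuousAt U x) {r : ℝ} (hweak : ∀ φ : 𝔼 → ℝ, IsTestOn φ (Metric.ball x r) →
      weakIterLaplacian m U φ = 0) {ε : ℝ} (hε : 0 < ε) (hεr : ε < r) :
    radialMean k U x ε = U x * ∫ y : 𝔼, k (‖y‖ ^ 2) := by
  have hd : ∀ s ∈ Ioo 0 r, HasDerivAt (radialMean k U x) 0 s := by
    intro s hs
    convert! hasDerivAt_radialMean hk hU x hs.1 using 1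
    have hG : ContDiff ℝ ∞ (fun y : 𝔼 => f (‖y‖ ^ 2)) := by
      simpa using contDiff_radial (n := n) hf.contDiff 0
    have hL : iterLaplacian m (fun y : 𝔼 => f (‖y‖ ^ 2)) =
        fun y => (radialLap n)^[m] f (‖y‖ ^ 2) := by
      simpa using iterLaplacian_radial hf.contDiff (0 : 𝔼) m
    have htest : IsTestOn (fun y : 𝔼 => f (‖s⁻¹ • (y - x)‖ ^ 2)) (Metric.ball x r) := by
      refine ⟨hG.comp (by fun_prop : ContDiff ℝ ∞ fun y : 𝔼 => s⁻¹ • (y - x)),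
        hf.hasCompactSupport x hs.1, (tsupport_comp_homothety_subset
          (η := fun y : 𝔼 => f (‖y‖ ^ 2)) (fun y hy => hf.eq_zero _ (one_le_pow₀ hy.le)) x
          hs.1).trans (Metric.closedBall_subset_ball hs.2)⟩
    have h := hweak _ htest
    rw [weakIterLaplacian, iterLaplacian_comp_homothety hG, hL] at h
    have hs0 : s ≠ 0 := hs.1.ne'
    -- By `hkf` the `s`-derivative of the mean is a multiple of the pairing of `Δ^m U` with a dilate
    -- of `f(‖y‖²)`, a test function in the ball because `s < r`.
    have he : ∀ y : 𝔼, U y * (-(s ^ (n + 1))⁻¹ * radialEuler n k (‖s⁻¹ • (y - x)‖ ^ 2)) =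
        (-(s ^ (n + 1))⁻¹ * s ^ (2 * m)) *
          (U y * ((s⁻¹) ^ (2 * m) * (radialLap n)^[m] f (‖s⁻¹ • (y - x)‖ ^ 2))) := by
      intro y
      rw [hkf, inv_pow]
      field_simp
    simp only [he]
    rw [integral_const_mul, h, mul_zero]
  have hconst : ∀ s ∈ Ioo 0 r, radialMean k U x s = radialMean k U x ε := fun s hs =>
    isOpen_Ioo.is_const_of_deriv_eq_zero isPreconnected_Ioo
      (fun t ht => (hd t ht).differentiableAt.differentiableWithinAt)
      (fun t ht => (hd t ht).deriv) hs ⟨hε, hεr⟩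
  refine tendsto_nhds_unique (Tendsto.congr' ?_ tendsto_const_nhds) (tendsto_radialMean hk hU hx)
  filter_upwards [Ioo_mem_nhdsGT (hε.trans hεr)] with s hs using (hconst s hs).symm

lemma contDiff_radialMean {k : ℝ → ℝ} (hk : IsRadialProfile k) {U : 𝔼 → ℝ} (hU : Integrable U)
    {ε : ℝ} (hε : 0 < ε) : ContDiff ℝ ∞ (fun x => radialMean k U x ε) := by
  set K : 𝔼 → ℝ := fun z => (ε ^ n)⁻¹ * k (‖ε⁻¹ • z‖ ^ 2)
  have hKs : HasCompactSupport K := by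
    have h := (hk.hasCompactSupport (0 : 𝔼) hε).mul_left (f := fun _ => (ε ^ n)⁻¹)
    simp only [sub_zero] at h
    exact h
  have hKc : ContDiff ℝ ∞ K := contDiff_const.mul (hk.contDiff.comp
    ((by fun_prop : ContDiff ℝ ∞ fun z : 𝔼 => ε⁻¹ • z).norm_sq ℝ))
  have h := hKs.contDiff_convolution_right (n := ⊤) (ContinuousLinearMap.mul ℝ ℝ)
    hU.locallyIntegrable hKc
  have he : (fun x => radialMean k U x ε) =
      convolution U K (ContinuousLinearMap.mul ℝ ℝ) volume := by
    ext x
    simp only [radialMean, convolution, ContinuousLinearMap.mul_apply', K]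
    congr 1
    ext y
    rw [smul_sub, smul_sub, norm_sub_rev]
  rw [he]
  exact h

/-- The means at the fixed scale `R / 4` reproduce `U` wherever it is continuous. Their balls may
contain `a`, which is why the weak equation is needed across `a`. -/
lemma exists_smooth_extension_of_weak {m : ℕ} (hm : 1 ≤ m) {U : 𝔼 → ℝ} {a : 𝔼} {R : ℝ} (hR : 0 < R)
    (hU : Integrable U) (hc : ContinuousOn U (Metric.ball a R \ {a}))
    (hweak : ∀ φ : 𝔼 → ℝ, IsTestOn φ (Metric.ball a R) → weakIterLaplacian m U φ = 0) :
    ∃ v : 𝔼 → ℝ, ContDiff ℝ ∞ v ∧ ∀ x ∈ Metric.ball a (R / 2), x ≠ a → U x = v x := by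
  obtain ⟨f, k, hf, hk, hkf, hI⟩ := exists_radial_kernel (n := n) hm
  refine ⟨fun x => radialMean k U x (R / 4) * (∫ y : 𝔼, k (‖y‖ ^ 2))⁻¹,
    (contDiff_radialMean hk hU (by positivity)).mul contDiff_const, fun x hx hxa => ?_⟩
  have hopen : IsOpen (Metric.ball a R \ {a}) := Metric.isOpen_ball.sdiff isClosed_singleton
  have hsub : Metric.ball x (R / 2) ⊆ Metric.ball a R := by
    refine Metric.ball_subset_ball' ?_
    rw [Metric.mem_ball] at hx
    linarith
  have hx' : x ∈ Metric.ball a R \ {a} :=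
    ⟨Metric.ball_subset_ball (by linarith) hx, hxa⟩
  beta_reduce
  rw [radialMean_eq_of_weak hf hk hkf hU (hc.continuousAt (hopen.mem_nhds hx')) (r := R / 2)
    (fun φ hφ => hweak φ ⟨hφ.contDiff, hφ.hasCompactSupport, hφ.tsupport_subset.trans hsub⟩)
    (by positivity) (by linarith), mul_inv_cancel_right₀ hI]

end Regularity

/-! ### Removability and sharpness -/

section RemovableSingularities

set_option maxSynthPendingDepth 3

open MeasureTheory

variable {n : ℕ}

local notation "𝔼" => EuclideanSpace ℝ (Fin n)

lemma IsPolyharmonicOn.congr {m : ℕ} {u v : 𝔼 → ℝ} {V : Set 𝔼} (hV : IsOpen V)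
    (hu : IsPolyharmonicOn m u V) (h : ∀ x ∈ V, v x = u x) : IsPolyharmonicOn m v V := by
  refine ⟨hu.1.congr h, fun x hx => ?_⟩
  have hev : v =ᶠ[𝓝 x] u := by
    filter_upwards [hV.mem_nhds hx] with y hy using h y hy
  rw [(iterLaplacian_congr_nhds hev m).eq_of_nhds, hu.2 x hx]

lemma IsPolyharmonicOn.mono {m : ℕ} {u : 𝔼 → ℝ} {V W : Set 𝔼} (hu : IsPolyharmonicOn m u V)
    (h : W ⊆ V) : IsPolyharmonicOn m u W :=
  ⟨hu.1.mono h, fun x hx => hu.2 x (h hx)⟩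

/-- A smooth function that is polyharmonic off a point is polyharmonic. -/
lemma isPolyharmonicOn_of_diff_singleton (hn : 1 ≤ n) {m : ℕ} {v : 𝔼 → ℝ} (hv : ContDiff ℝ ∞ v)
    {a : 𝔼} {V : Set 𝔼} (hV : IsOpen V) (h : IsPolyharmonicOn m v (V \ {a})) :
    IsPolyharmonicOn m v V := by
  have : Nonempty (Fin n) := ⟨⟨0, hn⟩⟩
  refine ⟨(hv.of_le (natCast_le_infty _)).contDiffOn, fun x hx => ?_⟩
  by_cases hxa : x = a
  · subst hxa
    have h1 : Tendsto (iterLaplacian m v) (𝓝[≠] x) (𝓝 (iterLaplacian m v x)) :=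
      ((hv.iterLaplacian m).continuous.tendsto x).mono_left nhdsWithin_le_nhds
    refine tendsto_nhds_unique h1 (Tendsto.congr' ?_ tendsto_const_nhds)
    filter_upwards [self_mem_nhdsWithin, mem_nhdsWithin_of_mem_nhds (hV.mem_nhds hx)] with y hy hyV
    exact (h.2 y ⟨hyV, hy⟩).symm
  · exact h.2 x ⟨hx, hxa⟩

lemma integrableOn_ball_of_continuousOn_punctured {u w : 𝔼 → ℝ} {a : 𝔼} {R : ℝ} (hn : 1 ≤ n)
    (hu : ContinuousOn u (Metric.ball a R \ {a})) (hw : IntegrableOn w (Metric.ball a R))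
    (h : ∀ y ∈ Metric.ball a R \ {a}, |u y| ≤ w y) : IntegrableOn u (Metric.ball a R) := by
  have : Nonempty (Fin n) := ⟨⟨0, hn⟩⟩
  have hmeas : MeasurableSet (Metric.ball a R \ {a}) :=
    (Metric.isOpen_ball.sdiff isClosed_singleton).measurableSet
  have h1 : IntegrableOn u (Metric.ball a R \ {a}) := by
    refine Integrable.mono' (hw.mono_set sdiff_subset) (hu.aestronglyMeasurable hmeas) ?_
    exact (ae_restrict_iff' hmeas).2 (ae_of_all _ h)
  exact h1.congr_set_ae (ae_eq_set.2 ⟨measure_mono_null (by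
    intro y hy
    by_contra hya
    exact hy.2 ⟨hy.1, hya⟩) (measure_singleton a), by simp⟩)

/-- The common part of the removability statements: `hw` is the integrability of the growth
function, and `hzero` says that `Δ^m` of an integrable function of that growth has no mass at
`a`. -/
lemma hasRemovableSingularity_of_isLittleO (hn : 1 ≤ n) {m : ℕ} (hm : 1 ≤ m) {Ω : Set 𝔼} {a : 𝔼}
    {u w : 𝔼 → ℝ} (hΩ : IsOpen Ω) (ha : a ∈ Ω) (hu : IsPolyharmonicOn m u (Ω \ {a}))
    (huw : u =o[𝓝[≠] a] w) {r : ℝ} (hr : 0 < r) (hw : IntegrableOn w (Metric.ball a r))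
    (hzero : ∀ (U : 𝔼 → ℝ) (R : ℝ), 0 < R → Integrable U → U =o[𝓝[≠] a] w →
      IsPolyharmonicOn m U (Metric.ball a R \ {a}) →
      ∀ φ, IsTestOn φ (Metric.ball a R) → weakIterLaplacian m U φ = 0) :
    HasRemovableSingularity m u Ω a := by
  obtain ⟨r₁, hr₁, hb⟩ := Metric.mem_nhdsWithin_iff.1 (huw.bound one_pos)
  obtain ⟨r₂, hr₂, hΩ₂⟩ := Metric.isOpen_iff.1 hΩ a ha
  set R : ℝ := min r (min r₁ r₂)
  have hR : 0 < R := lt_min hr (lt_min hr₁ hr₂)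
  have hRr : R ≤ r := min_le_left _ _
  have hR₁ : R ≤ r₁ := (min_le_right _ _).trans (min_le_left _ _)
  have hR₂ : R ≤ r₂ := (min_le_right _ _).trans (min_le_right _ _)
  have hopen : IsOpen (Metric.ball a R \ {a}) := Metric.isOpen_ball.sdiff isClosed_singleton
  have hu' : IsPolyharmonicOn m u (Metric.ball a R \ {a}) :=
    hu.mono (sdiff_subset_sdiff_left ((Metric.ball_subset_ball hR₂).trans hΩ₂))
  have hint : IntegrableOn u (Metric.ball a R) := by
    refine integrableOn_ball_of_continuousOn_punctured hn hu'.1.continuousOn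
      (hw.mono_set (Metric.ball_subset_ball hRr)).norm fun y hy => ?_
    have h1 := hb ⟨Metric.ball_subset_ball hR₁ hy.1, hy.2⟩
    simpa using h1
  -- Cutting off makes `U` globally integrable without changing its germ at `a`.
  set U : 𝔼 → ℝ := (Metric.ball a R).indicator u
  have hUint : Integrable U := (integrable_indicator_iff measurableSet_ball).2 hint
  have hUu : ∀ x ∈ Metric.ball a R, U x = u x := fun x hx => indicator_of_mem hx u
  have hUo : U =o[𝓝[≠] a] w := by
    refine huw.congr' ?_ EventuallyEq.rfl
    filter_upwards [mem_nhdsWithin_of_mem_nhds (Metric.ball_mem_nhds a hR)] with x hx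
    exact (hUu x hx).symm
  have hUp : IsPolyharmonicOn m U (Metric.ball a R \ {a}) :=
    hu'.congr hopen fun x hx => hUu x hx.1
  obtain ⟨v, hv, hUv⟩ := exists_smooth_extension_of_weak hm hR hUint hUp.1.continuousOn
    (hzero U R hR hUint hUo hUp)
  have hsub : Metric.ball a (R / 2) ⊆ Metric.ball a R := Metric.ball_subset_ball (by linarith)
  refine ⟨R / 2, by positivity,
    (Metric.closedBall_subset_ball (by linarith)).trans hΩ₂, v, hv.contDiffOn,
    isPolyharmonicOn_of_diff_singleton (a := a) hn hv Metric.isOpen_ball ?_, fun x hx0 hx => ?_⟩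
  · refine (hUp.mono (sdiff_subset_sdiff_left hsub)).congr
      (Metric.isOpen_ball.sdiff isClosed_singleton) fun x hx => (hUv x hx.1 hx.2).symm
  · have hxb : x ∈ Metric.ball a (R / 2) := by rwa [Metric.mem_ball, dist_eq_norm]
    rw [← hUu x (hsub hxb)]
    exact hUv x hxb (sub_ne_zero.1 (norm_pos_iff.1 hx0))

lemma hasRemovableSingularity_of_isLittleO_zpow (hn : 1 ≤ n) {m : ℕ} (hm : 1 ≤ m) {Ω : Set 𝔼}
    {a : 𝔼} {u : 𝔼 → ℝ} (hΩ : IsOpen Ω) (ha : a ∈ Ω) (hu : IsPolyharmonicOn m u (Ω \ {a}))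
    (huo : u =o[𝓝[≠] a] fun x => ‖x - a‖ ^ (2 * (m : ℤ) - n)) :
    HasRemovableSingularity m u Ω a :=
  hasRemovableSingularity_of_isLittleO hn hm hΩ ha hu huo one_pos
    (integrableOn_norm_sub_zpow_ball hn hm a 1) fun _ _ hR hU hUo hUp _ hφ =>
      weakIterLaplacian_eq_zero_of_tendsto_scaledMass hR hU hUp
        (tendsto_scaledMass_of_isLittleO hn hm hU hUo) hφ

lemma integrableOn_norm_sub_zpow_mul_log {m : ℕ} (hm : 2 ≤ m) (a : EuclideanSpace ℝ (Fin 2)) :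
    IntegrableOn (fun x => ‖x - a‖ ^ (2 * (m : ℤ) - 2) * Real.log (1 / ‖x - a‖))
      (Metric.ball a (Real.exp (-1))) := by
  have hc : ContinuousOn (fun x : EuclideanSpace ℝ (Fin 2) =>
      ‖x - a‖ ^ (2 * (m : ℤ) - 2) * Real.log (1 / ‖x - a‖))
      (Metric.ball a (Real.exp (-1)) \ {a}) := by
    have hne : ∀ x ∈ Metric.ball a (Real.exp (-1)) \ {a}, ‖x - a‖ ≠ 0 := fun x hx =>
      norm_ne_zero_iff.2 (sub_ne_zero.2 hx.2)
    have hcn : ContinuousOn (fun x : EuclideanSpace ℝ (Fin 2) => ‖x - a‖)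
        (Metric.ball a (Real.exp (-1)) \ {a}) := by fun_prop
    exact (hcn.zpow₀ _ fun x hx => Or.inl (hne x hx)).mul
      ((continuousOn_const.div hcn hne).log fun x hx => one_div_ne_zero (hne x hx))
  refine integrableOn_ball_of_continuousOn_punctured (by norm_num) hc
    (w := fun _ => Real.exp (-1) ^ (2 * m - 2) * Real.log (1 / Real.exp (-1)))
    (integrableOn_const (measure_ball_lt_top).ne) fun y hy => ?_
  have hpos : 0 < ‖y - a‖ := norm_pos_iff.2 (sub_ne_zero.2 hy.2)
  have hyb := hy.1
  rw [Metric.mem_ball, dist_eq_norm] at hyb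
  have h3 : ‖y - a‖ ^ (2 * (m : ℤ) - 2) = ‖y - a‖ ^ (2 * m - 2) := by
    rw [← zpow_natCast]
    congr 1
    push_cast [Nat.cast_sub (show 2 ≤ 2 * m by omega)]
    ring
  have h1 : Real.exp (-1) ≤ 1 := Real.exp_le_one_iff.2 (by norm_num)
  have h4 : 0 ≤ Real.log (1 / ‖y - a‖) :=
    Real.log_nonneg ((one_le_div hpos).2 (hyb.le.trans h1))
  rw [h3, abs_of_nonneg (by positivity)]
  exact pow_mul_log_inv_mono (by omega) hpos hyb.le le_rfl

lemma hasRemovableSingularity_of_isLittleO_log {m : ℕ} (hm : 2 ≤ m)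
    {Ω : Set (EuclideanSpace ℝ (Fin 2))} {a : EuclideanSpace ℝ (Fin 2)}
    {u : EuclideanSpace ℝ (Fin 2) → ℝ} (hΩ : IsOpen Ω) (ha : a ∈ Ω)
    (hu : IsPolyharmonicOn m u (Ω \ {a}))
    (huo : u =o[𝓝[≠] a] fun x => ‖x - a‖ ^ (2 * (m : ℤ) - 2) * Real.log (1 / ‖x - a‖)) :
    HasRemovableSingularity m u Ω a :=
  hasRemovableSingularity_of_isLittleO (by norm_num) (by omega) hΩ ha hu huo (Real.exp_pos _)
    (integrableOn_norm_sub_zpow_mul_log hm a) fun _ _ hR hU hUo hUp _ hφ =>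
      weakIterLaplacian_eq_zero_of_tendsto_scaledMass_div_log (by omega) hR hU hUp
        (tendsto_scaledMass_div_log_of_isLittleO hm hU hUo) hφ

lemma isPolyharmonicOn_norm_zpow {m : ℕ} (hm : 1 ≤ m) :
    IsPolyharmonicOn m (fun x : 𝔼 => ‖x‖ ^ (2 * (m : ℤ) - n)) (univ \ {0}) := by
  refine ⟨fun x hx => (contDiffAt_norm_zpow _ hx.2).contDiffWithinAt, fun x hx => ?_⟩
  -- At `i = m - 1` the power reached is `2 - n`, the harmonic one, and the second factor vanishes.
  rw [iterLaplacian_norm_zpow _ _ hx.2, Finset.prod_eq_zero (i := m - 1), zero_mul]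
  · exact Finset.mem_range.2 (by omega)
  · push_cast [Nat.cast_sub hm]
    ring

/-- The constant in `Δ^(m-1) ‖x‖^(2m-n) = A ‖x‖^(2-n)`. -/
lemma exists_iterLaplacian_norm_zpow {m : ℕ} (hm : 1 ≤ m)
    (hpar : Odd n ∨ (Even n ∧ m + 1 ≤ n / 2)) : ∃ A : ℝ, A ≠ 0 ∧ ∀ x : 𝔼, x ≠ 0 →
      iterLaplacian (m - 1) (fun y : 𝔼 => ‖y‖ ^ (2 * (m : ℤ) - n)) x = A * ‖x‖ ^ (2 - (n : ℤ)) := by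
  set k : ℤ := 2 * (m : ℤ) - n with hk
  refine ⟨∏ i ∈ Finset.range (m - 1), ((k : ℝ) - 2 * i) * (k - 2 * i + n - 2),
    Finset.prod_ne_zero_iff.2 fun i hi => mul_ne_zero (fun h => ?_) (fun h => ?_), fun x hx => ?_⟩
  -- `2m - n - 2i` is odd when `n` is odd, and negative when `2m ≤ n - 2`.
  · have h' : k - 2 * i = 0 := by exact_mod_cast h
    rcases hpar with ⟨j, hj⟩ | ⟨-, hj⟩ <;> omega
  · have hi' := Finset.mem_range.1 hi
    have h' : k - 2 * i + n - 2 = 0 := by exact_mod_cast h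
    omega
  · rw [iterLaplacian_norm_zpow _ _ hx, hk]
    congr 2
    push_cast [Nat.cast_sub hm]
    ring

lemma tendsto_norm_zpow_atTop (hn : 3 ≤ n) :
    Tendsto (fun x : 𝔼 => ‖x‖ ^ (2 - (n : ℤ))) (𝓝[≠] 0) atTop := by
  have h1 : Tendsto (fun x : 𝔼 => ‖x‖) (𝓝[≠] 0) (𝓝[>] 0) := tendsto_norm_nhdsNE_zero
  have h2 : Tendsto (fun s : ℝ => (s⁻¹) ^ (n - 2)) (𝓝[>] 0) atTop :=
    (tendsto_pow_atTop (by omega)).comp tendsto_inv_nhdsGT_zero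
  refine (h2.comp h1).congr fun x => ?_
  rw [Function.comp, inv_pow, ← zpow_natCast, ← zpow_neg]
  congr 1
  push_cast [Nat.cast_sub (show 2 ≤ n by omega)]
  ring

/-- `Δ^(m-1)` of an extension would be continuous at `0`, yet off `0` it equals `A ‖x‖^(2-n)` with
`A ≠ 0`, which is unbounded as `n ≥ 3`. -/
lemma not_hasRemovableSingularity_norm_zpow (hn : 3 ≤ n) {m : ℕ} (hm : 1 ≤ m)
    (hpar : Odd n ∨ (Even n ∧ m + 1 ≤ n / 2)) :
    ¬ HasRemovableSingularity m (fun x : 𝔼 => ‖x‖ ^ (2 * (m : ℤ) - n)) univ 0 := by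
  have : Nonempty (Fin n) := ⟨⟨0, by omega⟩⟩
  rintro ⟨δ, hδ, -, v, hv, -, huv⟩
  obtain ⟨A, hA, hAx⟩ := exists_iterLaplacian_norm_zpow (n := n) hm hpar
  have hcont : ContinuousAt (iterLaplacian (m - 1) v) 0 :=
    (ContDiffAt.iterLaplacian (k := 0) ((hv.contDiffAt (Metric.ball_mem_nhds _ hδ)).of_le
      (by rw [zero_add]; exact natCast_le_infty _))).continuousAt
  have hlim : Tendsto (iterLaplacian (m - 1) v) (𝓝[≠] 0) (𝓝 (iterLaplacian (m - 1) v 0)) :=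
    hcont.tendsto.mono_left nhdsWithin_le_nhds
  have hlim' : Tendsto (fun x : 𝔼 => A⁻¹ * iterLaplacian (m - 1) v x) (𝓝[≠] 0)
      (𝓝 (A⁻¹ * iterLaplacian (m - 1) v 0)) := hlim.const_mul _
  refine not_tendsto_nhds_of_tendsto_atTop (tendsto_norm_zpow_atTop hn) _ (hlim'.congr' ?_)
  have hopen : IsOpen (Metric.ball (0 : 𝔼) δ \ {0}) := Metric.isOpen_ball.sdiff isClosed_singleton
  filter_upwards [self_mem_nhdsWithin, mem_nhdsWithin_of_mem_nhds (Metric.ball_mem_nhds _ hδ)]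
    with x hx hxδ
  have hev : (fun x : 𝔼 => ‖x‖ ^ (2 * (m : ℤ) - n)) =ᶠ[𝓝 x] v := by
    filter_upwards [hopen.mem_nhds ⟨hxδ, hx⟩] with y hy
    refine huv y ?_ ?_
    · rw [sub_zero]
      exact norm_pos_iff.2 hy.2
    · rw [sub_zero]
      exact mem_ball_zero_iff.1 hy.1
  rw [← (iterLaplacian_congr_nhds hev (m - 1)).eq_of_nhds, hAx x hx, inv_mul_cancel_left₀ hA]

end RemovableSingularities

theorem theorem2 (n m : ℕ) (hn : 2 ≤ n) :
    -- removability, for `m ≥ 2` and `n ≥ 2`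
    (2 ≤ m →
      ∀ (Ω : Set (EuclideanSpace ℝ (Fin n))) (x₀ : EuclideanSpace ℝ (Fin n))
        (u : EuclideanSpace ℝ (Fin n) → ℝ),
        IsOpen Ω → IsConnected Ω → x₀ ∈ Ω → IsPolyharmonicOn m u (Ω \ {x₀}) →
        (3 ≤ n → u =o[𝓝[≠] x₀] fun x => ‖x - x₀‖ ^ (2 * (m : ℤ) - (n : ℤ))) →
        (n = 2 → u =o[𝓝[≠] x₀] fun x => ‖x - x₀‖ ^ (2 * (m : ℤ) - 2) * Real.log (1 / ‖x - x₀‖)) →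
        HasRemovableSingularity m u Ω x₀) ∧
    -- sharpness: `|x| ^ (2m - n)` is a solution off `0` whose singularity is not removable
    (3 ≤ n → 1 ≤ m → (Odd n ∨ (Even n ∧ m + 1 ≤ n / 2)) →
      IsPolyharmonicOn m
        (fun x : EuclideanSpace ℝ (Fin n) => ‖x‖ ^ (2 * (m : ℤ) - (n : ℤ))) (univ \ {0}) ∧
      (∃ A : ℝ, A ≠ 0 ∧ ∀ x : EuclideanSpace ℝ (Fin n), x ≠ 0 →
        iterLaplacian (m - 1)
          (fun y : EuclideanSpace ℝ (Fin n) => ‖y‖ ^ (2 * (m : ℤ) - (n : ℤ))) x =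
          A * ‖x‖ ^ (2 - (n : ℤ))) ∧
      ¬ HasRemovableSingularity m
        (fun x : EuclideanSpace ℝ (Fin n) => ‖x‖ ^ (2 * (m : ℤ) - (n : ℤ))) univ 0) := by
  refine ⟨fun hm Ω x₀ u hΩ _ hx₀ hu h3 h2 => ?_, fun hn3 hm hpar =>
    ⟨isPolyharmonicOn_norm_zpow hm, exists_iterLaplacian_norm_zpow hm hpar,
      not_hasRemovableSingularity_norm_zpow hn3 hm hpar⟩⟩
  rcases hn.eq_or_lt with rfl | hn3
  · exact hasRemovableSingularity_of_isLittleO_log hm hΩ hx₀ hu (h2 rfl)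
  · exact hasRemovableSingularity_of_isLittleO_zpow (by omega) (by omega) hΩ hx₀ hu (h3 hn3)
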